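/- Let $\mathbb H$ be the hyperbolic plane (curvature $-1$) and let $\alpha\in(0,\pi/2)$. An *$\alpha$-quadrangle* is a quadrilateral in $\mathbb H$ (a simple closed polygon formed by four geodesic segments, with vertices $p_0,p_1,p_2,p_3$ labelled in cyclic order) all of whose interior angles are equal to $\alpha$. Two $\alpha$-quadrangles $p,q$ are *congruent as labelled quadrilaterals* if some isometry $f$ of $\mathbb H$ (orientation-preserving or not) satisfies $f(p_i)=q_i$ for all $i$, and *congruent* if some isometry maps the vertex set of $p$ onto that of $q$. 1. The $\alpha$-quadrangles form a one-parameter family: there is a family $F_\gamma$, depending continuously on $\gamma\in(0,\alpha)$, of $\alpha$-quadrangles such that $\gamma$ is the angle of $F_\gamma$ at $p_0$ between the edge $p_0p_1$ and the diagonal $p_0p_2$; every $\alpha$-quadrangle is congruent as a labelled quadrilateral to $F_\gamma$ for exactly one $\gamma\in(0,\alpha)$; and, disregarding labels, $F_\gamma$ and $F_{\gamma'}$ are congruent if and only if $\gamma'=\gamma$ or $\gamma'=\alpha-\gamma$. 2. Every $\alpha$-quadrangle has all the symmetries of a Euclidean rectangle: there are reflections of $\mathbb H$ in geodesics which act on the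 vertices by $p_0\leftrightarrow p_1,\ p_2\leftrightarrow p_3$ and by $p_0\leftrightarrow p_3,\ p_1\leftrightarrow p_2$, respectively, and a rotation about a point of $\mathbb H$ which acts by $p_0\leftrightarrow p_2,\ p_1\leftrightarrow p_3$. 3. Up to isometry there is a unique $\alpha$-square, that is, an $\alpha$-quadrangle with all the symmetries of a square: for every $k$ modulo $4$ there is a reflection of $\mathbb H$ in a geodesic with $p_i\mapsto p_{k-i}$ for all $i$, and for every $k\not\equiv 0$ there is a rotation of $\mathbb H$ about a point with $p_i\mapsto p_{i+k}$ for all $i$ (indices modulo $4$). More precisely, an $\alpha$-square exists and any two are congruent as labelled quadrilaterals. In particular, all the sides of an $\alpha$-square have the same length. -/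

import Mathlib

open UpperHalfPlane Set

noncomputable section

namespace HypQuad

/-- The geodesic segment between two points of the hyperbolic plane, here the upper half-plane
`ℍ` with its hyperbolic metric of curvature `-1`. -/
def seg (x y : ℍ) : Set ℍ := {z | dist x z + dist z y = dist x y}

/-- Complete geodesics: the images of the isometric embeddings of the real line. -/
def IsGeodesicLine (L : Set ℍ) : Prop := ∃ g : ℝ → ℍ, Isometry g ∧ range g = L

/-- A positive multiple of the initial velocity, in the tangent space `ℂ` of `ℍ` at `x`, of the
geodesic from `x` to `y`. (The map `y ↦ (y - x) / (y - conj x)` is the conformal isometry onto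
the disc model taking `x` to the origin. It takes geodesics from `x` to straight segments from the
origin, and its derivative at `x` is a positive multiple of `-I`.) It is `0` if `y = x`. -/
def dir (x y : ℍ) : ℂ :=
  Complex.I * (((y : ℂ) - (x : ℂ)) / ((y : ℂ) - (starRingEnd ℂ) (x : ℂ)))

/-- The hyperbolic angle, in `[0, π]`, at the vertex `x` between the geodesics from `x` to `y` and
from `x` to `z`. The upper half-plane is a conformal model, so this is the Euclidean angle
between the initial velocities. -/
def angleAt (x y z : ℍ) : ℝ := InnerProductGeometry.angle (dir x y) (dir x z)

/-- Four points of the hyperbolic plane in cyclic order. -/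
abbrev Quad : Type := ZMod 4 → ℍ

/-- The four points are the successive vertices of a quadrilateral, a simple closed polygon whose
edges are the segments from `p i` to `p (i + 1)`: the vertices are distinct, adjacent edges
meet only in their common vertex, and opposite edges are disjoint. -/
structure Quad.IsSimple (p : Quad) : Prop where
  injective : Function.Injective p
  adjacent : ∀ i, seg (p i) (p (i + 1)) ∩ seg (p (i + 1)) (p (i + 2)) = {p (i + 1)}
  opposite : ∀ i, Disjoint (seg (p i) (p (i + 1))) (seg (p (i + 2)) (p (i + 3)))

/-- The (full) geodesic triangle spanned by three points. -/
def triangle (x y z : ℍ) : Set ℍ := {w | ∃ v ∈ seg y z, w ∈ seg x v}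

open Classical in
/-- The interior angle of a quadrilateral at its vertex `p i`. In a simple quadrilateral a vertex
is reflex (or flat) exactly if it lies in the triangle spanned by the other three vertices.
The interior angle there is `2π` minus the angle, in `[0, π]`, between the two edges at that
vertex; at any other vertex it is the angle between the two edges. -/
def Quad.interiorAngle (p : Quad) (i : ZMod 4) : ℝ :=
  if p i ∈ triangle (p (i + 2)) (p (i + 1)) (p (i + 3)) then
    2 * Real.pi - angleAt (p i) (p (i + 1)) (p (i + 3))
  else angleAt (p i) (p (i + 1)) (p (i + 3))

/-- An `α`-quadrangle: a quadrilateral in the hyperbolic plane, all of whose interior angles are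
equal to `α`. -/
def Quad.IsAlphaQuadrangle (α : ℝ) (p : Quad) : Prop :=
  p.IsSimple ∧ ∀ i, p.interiorAngle i = α

/-- Reflections in a geodesic: isometries whose fixed points form a complete geodesic. -/
def IsReflection (f : ℍ ≃ᵢ ℍ) : Prop := IsGeodesicLine (Function.fixedPoints f)

/-- Nontrivial rotations: isometries with precisely one fixed point, the center. -/
def IsRotation (f : ℍ ≃ᵢ ℍ) : Prop := ∃ c, Function.fixedPoints f = {c}

/-- The symmetries of a Euclidean rectangle with successive vertices `0, 1, 2, 3` are the identity,
the reflections `i ↦ 1 - i` and `i ↦ 3 - i` in the perpendicular bisectors of the edges, and the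
half-turn `i ↦ i + 2`. The quadrilateral `p` has all these symmetries. -/
def Quad.HasRectangleSymmetries (p : Quad) : Prop :=
  (∃ f : ℍ ≃ᵢ ℍ, IsReflection f ∧ ∀ i, f (p i) = p (1 - i)) ∧
  (∃ f : ℍ ≃ᵢ ℍ, IsReflection f ∧ ∀ i, f (p i) = p (3 - i)) ∧
  (∃ f : ℍ ≃ᵢ ℍ, IsRotation f ∧ ∀ i, f (p i) = p (i + 2))

/-- The symmetries of a square with successive vertices `0, 1, 2, 3` are the identity, the
reflections `i ↦ k - i` (in the perpendicular bisectors of the edges for odd `k`, in the diagonals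
for even `k`), and the rotations `i ↦ i + k` for `k ≠ 0`. The quadrilateral `p` has all these
symmetries. -/
def Quad.HasSquareSymmetries (p : Quad) : Prop :=
  (∀ k, ∃ f : ℍ ≃ᵢ ℍ, IsReflection f ∧ ∀ i, f (p i) = p (k - i)) ∧
  (∀ k, k ≠ 0 → ∃ f : ℍ ≃ᵢ ℍ, IsRotation f ∧ ∀ i, f (p i) = p (i + k))

/-- An `α`-square: an `α`-quadrangle with all the symmetries of a square. -/
def Quad.IsAlphaSquare (α : ℝ) (p : Quad) : Prop :=
  p.IsAlphaQuadrangle α ∧ p.HasSquareSymmetries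

/-- Congruence of quadrilaterals with labelled vertices. -/
def Quad.Congruent (p q : Quad) : Prop := ∃ f : ℍ ≃ᵢ ℍ, ∀ i, f (p i) = q i

/-- Congruence of quadrilaterals without regard to the labelling of the vertices. -/
def Quad.CongruentUnlabelled (p q : Quad) : Prop := ∃ f : ℍ ≃ᵢ ℍ, f '' range p = range q

end HypQuad

end

/-! The hyperboloid model turns the geometry into linear algebra in `ℝ³`. The Lorentzian product
`lor` is the hyperbolic cosine of the distance, segments and triangles are cut out by cones, and
angles come from a tangent vector `tang x y` that is linear in `y`. Configurations with equal mutual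
distances are congruent (`exists_isometry_of_dist_eq`).

Rigidity: since `α < π/2`, no vertex is reflex. The four vertices are linearly dependent, and every
sign pattern of the relation except the alternating one would put a vertex in the triangle of the
others or make opposite sides meet (`exists_diagonal_relation`). So the diagonals cross, and `p₀p₂`
splits the angles at its ends into `γ + γ' = α` and `δ + δ' = α`. Both triangles on this diagonal
have angle `α` opposite to it, so the law of cosines for angles computes its length from `γ, δ` and
again from `γ', δ'`. Monotonicity of sine and cosine excludes `γ + δ < α` and `γ + δ > α`
(`not_add_lt`), so `δ = α - γ`. Hence `γ` determines all sides and this diagonal, and then the other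
diagonal (`Quad.IsAlphaQuadrangle.lor_eq`, `Quad.IsAlphaQuadrangle.congruent`).

Existence: `rect x y`, with vertices `(±x, ±y)`, has the right angles for `x² = cot α cot γ` and `y²
= cot α cot (α - γ)`. Its rectangle symmetries are orthogonal maps of the space-like plane, and
congruence carries them to every `α`-quadrangle. Unlabelled congruence is read off from the
distances between vertices. In a square adjacent sides are equal, which forces `γ = α / 2`. -/

noncomputable section

namespace HypQuad

/-! ### Coordinates of the hyperboloid model -/

/-- The first space-like coordinate of a point of `ℍ` in the hyperboloid model. -/
def hx (z : ℍ) : ℝ := (z.re ^ 2 + z.im ^ 2 - 1) / (2 * z.im)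

/-- The second space-like coordinate of a point of `ℍ` in the hyperboloid model. -/
def hy (z : ℍ) : ℝ := z.re / z.im

/-- The time-like coordinate of a point of `ℍ` in the hyperboloid model. -/
def ht (z : ℍ) : ℝ := (z.re ^ 2 + z.im ^ 2 + 1) / (2 * z.im)

/-- The Lorentzian product of two points of `ℍ` in the hyperboloid model. -/
def lor (z w : ℍ) : ℝ := ht z * ht w - hx z * hx w - hy z * hy w

theorem ht_pos (z : ℍ) : 0 < ht z := by
  have := z.im_pos
  unfold ht; positivity

theorem ht_sq (z : ℍ) : ht z ^ 2 = 1 + hx z ^ 2 + hy z ^ 2 := by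
  have := z.im_pos.ne'
  unfold ht hx hy
  field_simp
  ring

theorem lor_self (z : ℍ) : lor z z = 1 := by
  have := ht_sq z
  unfold lor; linarith

theorem lor_comm (z w : ℍ) : lor z w = lor w z := by
  unfold lor; ring

theorem cosh_dist_eq_lor (z w : ℍ) : Real.cosh (dist z w) = lor z w := by
  have h1 := z.im_pos.ne'
  have h2 := w.im_pos.ne'
  rw [cosh_dist, Complex.dist_eq, ← Complex.normSq_eq_norm_sq, Complex.normSq_apply]
  simp only [Complex.sub_re, Complex.sub_im, coe_re, coe_im]
  unfold lor ht hx hy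
  field_simp
  ring

theorem one_le_lor (z w : ℍ) : 1 ≤ lor z w := by
  rw [← cosh_dist_eq_lor]; exact Real.one_le_cosh _

theorem one_lt_lor {z w : ℍ} (h : z ≠ w) : 1 < lor z w := by
  rw [← cosh_dist_eq_lor]
  exact Real.one_lt_cosh.2 (dist_pos.2 h).ne'

theorem dist_eq_dist_iff {z w z' w' : ℍ} : dist z w = dist z' w' ↔ lor z w = lor z' w' := by
  rw [← cosh_dist_eq_lor, ← cosh_dist_eq_lor]
  refine ⟨fun h => by rw [h], fun h => ?_⟩
  exact Real.cosh_strictMonoOn.injOn (mem_Ici.2 dist_nonneg) (mem_Ici.2 dist_nonneg) h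

theorem eq_of_lor_eq_one {z w : ℍ} (h : lor z w = 1) : z = w := by
  by_contra hne
  exact (one_lt_lor hne).ne' h

theorem ext_hx_hy {z w : ℍ} (h1 : hx z = hx w) (h2 : hy z = hy w) : z = w := by
  have h3 : ht z = ht w := by
    have := ht_sq z; have := ht_sq w
    rw [h1, h2] at *
    exact (sq_eq_sq₀ (ht_pos z).le (ht_pos w).le).1 (by linarith)
  apply eq_of_lor_eq_one
  rw [← lor_self w]
  unfold lor; rw [h1, h2, h3]

/-- In hyperboloid coordinates `(x, y, t)` the point of `ℍ` is `(y + i) / (t - x)`, so this is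
positivity of the imaginary part. -/
theorem lt_sqrt_one_add (x y : ℝ) : 0 < √(1 + x ^ 2 + y ^ 2) - x := by
  have h : |x| < √(1 + x ^ 2 + y ^ 2) := by
    rw [← Real.sqrt_sq_eq_abs]
    exact Real.sqrt_lt_sqrt (sq_nonneg x) (by nlinarith [sq_nonneg y])
  linarith [le_abs_self x]

/-- The point of `ℍ` with given space-like coordinates in the hyperboloid model. -/
def ofXY (x y : ℝ) : ℍ :=
  ⟨⟨y / (√(1 + x ^ 2 + y ^ 2) - x), 1 / (√(1 + x ^ 2 + y ^ 2) - x)⟩,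
    by have := lt_sqrt_one_add x y; simp; linarith⟩

theorem hx_ofXY (x y : ℝ) : hx (ofXY x y) = x := by
  have h := lt_sqrt_one_add x y
  have h2 : √(1 + x ^ 2 + y ^ 2) ^ 2 = 1 + x ^ 2 + y ^ 2 := Real.sq_sqrt (by positivity)
  unfold hx ofXY
  simp only [mk_re, mk_im]
  generalize √(1 + x ^ 2 + y ^ 2) = t at *
  field_simp
  linear_combination -h2

theorem hy_ofXY (x y : ℝ) : hy (ofXY x y) = y := by
  have h := lt_sqrt_one_add x y
  unfold hy ofXY
  simp only [mk_re, mk_im]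
  field_simp

theorem ht_ofXY (x y : ℝ) : ht (ofXY x y) = √(1 + x ^ 2 + y ^ 2) := by
  rw [eq_comm, Real.sqrt_eq_iff_mul_self_eq (by positivity) (ht_pos _).le, ← pow_two, ht_sq,
    hx_ofXY, hy_ofXY]

theorem ht_ofXY_of_sq {x y t : ℝ} (ht0 : 0 < t) (h : t ^ 2 = 1 + x ^ 2 + y ^ 2) :
    ht (ofXY x y) = t := by
  rw [ht_ofXY, ← h, Real.sqrt_sq ht0.le]

theorem continuous_ofXY : Continuous fun p : ℝ × ℝ => ofXY p.1 p.2 := by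
  unfold ofXY
  refine Continuous.upperHalfPlaneMk ?_ _
  have hne : ∀ p : ℝ × ℝ, √(1 + p.1 ^ 2 + p.2 ^ 2) - p.1 ≠ 0 :=
    fun p => (lt_sqrt_one_add p.1 p.2).ne'
  have h : (fun p : ℝ × ℝ => (⟨p.2 / (√(1 + p.1 ^ 2 + p.2 ^ 2) - p.1),
      1 / (√(1 + p.1 ^ 2 + p.2 ^ 2) - p.1)⟩ : ℂ)) = fun p =>
      Complex.equivRealProdCLM.symm (p.2 / (√(1 + p.1 ^ 2 + p.2 ^ 2) - p.1),
      1 / (√(1 + p.1 ^ 2 + p.2 ^ 2) - p.1)) := by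
    funext p; apply Complex.ext <;> simp
  rw [h]
  refine (ContinuousLinearEquiv.continuous _).comp ?_
  refine Continuous.prodMk (Continuous.div (by fun_prop) (by fun_prop) hne)
    (Continuous.div (by fun_prop) (by fun_prop) hne)

/-! ### Segments and triangles as nonnegative combinations -/

/-- Points on a segment are combinations of its endpoints with nonnegative coefficients. -/
theorem exists_of_mem_seg {x y z : ℍ} (h : z ∈ seg x y) :
    ∃ s t : ℝ, 0 ≤ s ∧ 0 ≤ t ∧ hx z = s * hx x + t * hx y ∧ hy z = s * hy x + t * hy y ∧
      ht z = s * ht x + t * ht y := by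
  have h' : dist x z + dist z y = dist x y := h
  by_cases hxy : x = y
  · subst hxy
    rw [dist_comm z x, dist_self] at h'
    have : x = z := dist_eq_zero.1 (by linarith)
    subst this
    exact ⟨1, 0, by simp⟩
  have hS : 0 < Real.sinh (dist x y) := Real.sinh_pos_iff.2 (dist_pos.2 hxy)
  have hA : 0 ≤ Real.sinh (dist x z) := Real.sinh_nonneg_iff.2 dist_nonneg
  have hB : 0 ≤ Real.sinh (dist z y) := Real.sinh_nonneg_iff.2 dist_nonneg
  have hSe : Real.sinh (dist x y) = Real.sinh (dist x z) * Real.cosh (dist z y) +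
    Real.cosh (dist x z) * Real.sinh (dist z y) := by rw [← h', Real.sinh_add]
  have hCe : Real.cosh (dist x y) = Real.cosh (dist x z) * Real.cosh (dist z y) +
    Real.sinh (dist x z) * Real.sinh (dist z y) := by rw [← h', Real.cosh_add]
  have hA2 := Real.cosh_sq (dist x z)
  have hB2 := Real.cosh_sq (dist z y)
  simp only [cosh_dist_eq_lor] at *
  generalize Real.sinh (dist x y) = S at *
  generalize Real.sinh (dist x z) = A at *
  generalize Real.sinh (dist z y) = B at *
  have hz := ht_sq z; have hxx := ht_sq x; have hyy := ht_sq y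
  have hz0 := ht_pos z
  -- The vector `(a, b, c)` is the defect in `sinh d(x,y) • z = sinh d(z,y) • x + sinh d(x,z) • y`.
  -- It is orthogonal to the time-like `z` (`e1`) and null (`e2`), hence zero.
  obtain ⟨a, ha⟩ : ∃ a, a = S * hx z - (B * hx x + A * hx y) := ⟨_, rfl⟩
  obtain ⟨b, hb⟩ : ∃ b, b = S * hy z - (B * hy x + A * hy y) := ⟨_, rfl⟩
  obtain ⟨c, hc⟩ : ∃ c, c = S * ht z - (B * ht x + A * ht y) := ⟨_, rfl⟩
  have e1 : c * ht z - a * hx z - b * hy z = 0 := by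
    rw [ha, hb, hc]
    have : S * (lor z z) - B * lor x z - A * lor z y = 0 := by
      rw [lor_self, hSe]; ring
    unfold lor at this
    linear_combination this
  have e2 : c ^ 2 - a ^ 2 - b ^ 2 = 0 := by
    have : S ^ 2 + B ^ 2 + A ^ 2 - 2 * S * B * lor x z - 2 * S * A * lor z y
        + 2 * A * B * lor x y = 0 := by
      rw [hCe, hSe]; linear_combination (-B ^ 2) * hA2 - A ^ 2 * hB2
    rw [ha, hb, hc]
    unfold lor at this
    linear_combination this + S ^ 2 * hz + B ^ 2 * hxx + A ^ 2 * hyy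
  have e3 : a ^ 2 + b ^ 2 + (a * hy z - b * hx z) ^ 2 = 0 := by
    linear_combination (a ^ 2 + b ^ 2) * (-hz) + (-ht z ^ 2) * e2 +
      (c * ht z + a * hx z + b * hy z) * e1
  have ha0 : a = 0 := by
    refine pow_eq_zero_iff (two_ne_zero) |>.1 (le_antisymm ?_ (sq_nonneg a))
    linarith [sq_nonneg b, sq_nonneg (a * hy z - b * hx z)]
  have hb0 : b = 0 := by
    refine pow_eq_zero_iff (two_ne_zero) |>.1 (le_antisymm ?_ (sq_nonneg b))
    linarith [sq_nonneg a, sq_nonneg (a * hy z - b * hx z)]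
  have hc0 : c = 0 := by
    have : c ^ 2 = 0 := by rw [ha0, hb0] at e2; linarith
    exact pow_eq_zero_iff (two_ne_zero) |>.1 this
  refine ⟨B / S, A / S, by positivity, by positivity, ?_, ?_, ?_⟩ <;> field_simp <;> linarith

/-- Normalization of `z` gives `s² + t² + 2st·lor x y = 1`. Then `sinh d(x,z)` and `sinh d(z,y)` are
`t` and `s` times `sinh d(x,y)`, and the addition formula for `cosh` shows that the distances add
up. -/
theorem mem_seg_of_eq {x y z : ℍ} {s t : ℝ} (hs : 0 ≤ s) (ht0 : 0 ≤ t)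
    (h1 : hx z = s * hx x + t * hx y) (h2 : hy z = s * hy x + t * hy y)
    (h3 : ht z = s * ht x + t * ht y) : z ∈ seg x y := by
  have hz := ht_sq z; have hxx := ht_sq x; have hyy := ht_sq y
  have hC := cosh_dist_eq_lor x y
  have e1 : lor x z = s + t * lor x y := by
    unfold lor; rw [h1, h2, h3]; linear_combination s * hxx
  have e2 : lor z y = s * lor x y + t := by
    unfold lor; rw [h1, h2, h3]; linear_combination t * hyy
  have e3 : s ^ 2 + t ^ 2 + 2 * s * t * lor x y = 1 := by
    rw [h1, h2, h3] at hz
    unfold lor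
    linear_combination hz - s ^ 2 * hxx - t ^ 2 * hyy
  have hS : 0 ≤ Real.sinh (dist x y) := Real.sinh_nonneg_iff.2 dist_nonneg
  have hS2 := Real.cosh_sq (dist x y)
  have hA : Real.sinh (dist x z) = t * Real.sinh (dist x y) := by
    rw [← sq_eq_sq₀ (Real.sinh_nonneg_iff.2 dist_nonneg) (by positivity)]
    have := Real.cosh_sq (dist x z)
    rw [cosh_dist_eq_lor] at this hS2
    rw [e1] at this
    linear_combination (-1) * this + t ^ 2 * hS2 + e3
  have hB : Real.sinh (dist z y) = s * Real.sinh (dist x y) := by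
    rw [← sq_eq_sq₀ (Real.sinh_nonneg_iff.2 dist_nonneg) (by positivity)]
    have := Real.cosh_sq (dist z y)
    rw [cosh_dist_eq_lor] at this hS2
    rw [e2] at this
    linear_combination (-1) * this + s ^ 2 * hS2 + e3
  have key : Real.cosh (dist x z + dist z y) = Real.cosh (dist x y) := by
    rw [Real.cosh_add, hA, hB, cosh_dist_eq_lor, cosh_dist_eq_lor, e1, e2]
    rw [hC] at hS2 ⊢
    linear_combination (-s * t) * hS2 + lor x y * e3
  exact Real.cosh_strictMonoOn.injOn (mem_Ici.2 (by positivity)) (mem_Ici.2 dist_nonneg) key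

theorem exists_of_mem_triangle {x y z w : ℍ} (h : w ∈ triangle x y z) :
    ∃ a b c : ℝ, 0 ≤ a ∧ 0 ≤ b ∧ 0 ≤ c ∧ hx w = a * hx x + b * hx y + c * hx z ∧
      hy w = a * hy x + b * hy y + c * hy z ∧ ht w = a * ht x + b * ht y + c * ht z := by
  obtain ⟨v, hv, hw⟩ := h
  obtain ⟨s, t, hs, ht0, h1, h2, h3⟩ := exists_of_mem_seg hv
  obtain ⟨s', t', hs', ht0', h1', h2', h3'⟩ := exists_of_mem_seg hw
  refine ⟨s', t' * s, t' * t, hs', by positivity, by positivity, ?_, ?_, ?_⟩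
  · rw [h1', h1]; ring
  · rw [h2', h2]; ring
  · rw [h3', h3]; ring

/-- A nonzero combination with nonnegative coefficients of two points of the hyperboloid is a
positive multiple of a point of the hyperboloid. -/
theorem exists_pos_mul_eq (y z : ℍ) {b c : ℝ} (hb : 0 ≤ b) (hc : 0 ≤ c) (hbc : 0 < b + c) :
    ∃ v : ℍ, ∃ r : ℝ, 0 < r ∧ r * hx v = b * hx y + c * hx z ∧ r * hy v = b * hy y + c * hy z ∧
      r * ht v = b * ht y + c * ht z := by
  have hy1 := ht_sq y; have hz1 := ht_sq z
  have hl := one_le_lor y z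
  obtain ⟨n, hn⟩ : ∃ n, n = b ^ 2 + c ^ 2 + 2 * b * c * lor y z := ⟨_, rfl⟩
  have hn0 : 0 < n := by
    have : 0 ≤ b * c * (lor y z - 1) := by
      have : 0 ≤ lor y z - 1 := by linarith
      positivity
    nlinarith [sq_nonneg (b + c)]
  have hr : 0 < √n := Real.sqrt_pos.2 hn0
  have hr2 : √n ^ 2 = n := Real.sq_sqrt hn0.le
  have hT : 0 < b * ht y + c * ht z := by
    have := ht_pos y; have := ht_pos z
    rcases hb.lt_or_eq with h | h
    · positivity
    · have : 0 < c := by linarith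
      positivity
  refine ⟨ofXY ((b * hx y + c * hx z) / √n) ((b * hy y + c * hy z) / √n), √n, hr, ?_, ?_, ?_⟩
  · rw [hx_ofXY]; field_simp
  · rw [hy_ofXY]; field_simp
  · rw [ht_ofXY_of_sq (t := (b * ht y + c * ht z) / √n) (by positivity)]
    · field_simp
    · field_simp
      rw [hr2, hn]
      unfold lor
      linear_combination b ^ 2 * hy1 + c ^ 2 * hz1

theorem mem_triangle_of_eq {x y z w : ℍ} {a b c : ℝ} (ha : 0 ≤ a) (hb : 0 ≤ b) (hc : 0 ≤ c)
    (h1 : hx w = a * hx x + b * hx y + c * hx z) (h2 : hy w = a * hy x + b * hy y + c * hy z)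
    (h3 : ht w = a * ht x + b * ht y + c * ht z) : w ∈ triangle x y z := by
  rcases (add_nonneg hb hc).lt_or_eq with hbc | hbc
  · obtain ⟨v, r, hr, e1, e2, e3⟩ := exists_pos_mul_eq y z hb hc hbc
    refine ⟨v, mem_seg_of_eq (s := b / r) (t := c / r) (by positivity) (by positivity) ?_ ?_ ?_,
      mem_seg_of_eq (s := a) (t := r) ha hr.le ?_ ?_ ?_⟩
    · field_simp; linarith
    · field_simp; linarith
    · field_simp; linarith
    · linarith
    · linarith
    · linarith
  · have hb0 : b = 0 := by linarith
    have hc0 : c = 0 := by linarith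
    subst hb0 hc0
    exact ⟨y, mem_seg_of_eq (s := 1) (t := 0) zero_le_one le_rfl (by ring) (by ring) (by ring),
      mem_seg_of_eq (s := a) (t := 0) ha le_rfl (by linarith) (by linarith) (by linarith)⟩

/-! ### Isometries and congruence of finite configurations -/

/-- A surjection preserving the Lorentzian product is an isometry. -/
def isometryOfLor (f g : ℍ → ℍ) (hfg : ∀ x, f (g x) = x)
    (hf : ∀ z w, lor (f z) (f w) = lor z w) : ℍ ≃ᵢ ℍ :=
  IsometryEquiv.mk' f g hfg (Isometry.of_dist_eq fun z w => dist_eq_dist_iff.2 (hf z w))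

/-- By Cauchy–Schwarz, a vector on the lower sheet has negative product with every point of the
upper one. This keeps reflected points on the upper sheet. -/
theorem pos_of_lor_pos {x y t : ℝ} (q : ℍ) (h : t ^ 2 = 1 + x ^ 2 + y ^ 2)
    (hq : 0 < t * ht q - x * hx q - y * hy q) : 0 < t := by
  by_contra hn
  have hn' : t ≤ 0 := not_lt.1 hn
  have hq1 := ht_pos q
  have hq2 := ht_sq q
  have h1 : 0 ≤ -t * ht q := mul_nonneg (by linarith) hq1.le
  have h2 : (-t * ht q) ^ 2 < (x * hx q + y * hy q) ^ 2 := by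
    rw [← sq_abs (x * hx q + y * hy q)]
    refine pow_lt_pow_left₀ ?_ h1 two_ne_zero
    have := neg_abs_le (x * hx q + y * hy q)
    linarith
  nlinarith [sq_nonneg (x * hy q - y * hx q), sq_nonneg (hx q), sq_nonneg (hy q), sq_nonneg x,
    sq_nonneg y]

/-- Any two points are exchanged by an isometry that fixes all points equidistant from them. -/
theorem exists_isometry_swap (p q : ℍ) :
    ∃ f : ℍ ≃ᵢ ℍ, f p = q ∧ ∀ z, dist z p = dist z q → f z = z := by
  by_cases hpq : p = q
  · exact ⟨IsometryEquiv.refl ℍ, hpq, fun z _ => rfl⟩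
  have hne : 1 - lor p q ≠ 0 := by have := one_lt_lor hpq; linarith
  have hp := ht_sq p
  have hq := ht_sq q
  -- The Lorentzian reflection along `p - q` is `z ↦ z - k z • (p - q)` with `k z = 2⟨z, p - q⟩ / ⟨p
  -- - q, p - q⟩`, where `⟨p - q, p - q⟩ = 2 - 2 * lor p q`.
  let k : ℍ → ℝ := fun z => (lor z p - lor z q) / (1 - lor p q)
  have hk : ∀ z, k z * (1 - lor p q) = lor z p - lor z q := fun z => by
    simp only [k]; field_simp
  clear_value k
  let f : ℍ → ℍ := fun z => ofXY (hx z - k z * (hx p - hx q)) (hy z - k z * (hy p - hy q))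
  have hsq : ∀ z, (ht z - k z * (ht p - ht q)) ^ 2 = 1 + (hx z - k z * (hx p - hx q)) ^ 2 +
      (hy z - k z * (hy p - hy q)) ^ 2 := fun z => by
    have h1 := ht_sq z
    have h2 := hk z
    unfold lor at h2
    linear_combination h1 + 2 * k z * h2 + k z ^ 2 * (hp + hq)
  have hpos : ∀ z, 0 < ht z - k z * (ht p - ht q) := fun z => by
    refine pos_of_lor_pos q (hsq z) ?_
    have h1 := one_le_lor z p
    have h2 := hk z
    unfold lor at h1 h2
    -- The reflection takes `p` to `q`, so the product of the image of `z` with `q` is that of `z`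
    -- with `p`.
    have h3 : (ht z - k z * (ht p - ht q)) * ht q - (hx z - k z * (hx p - hx q)) * hx q -
        (hy z - k z * (hy p - hy q)) * hy q = ht z * ht p - hx z * hx p - hy z * hy p := by
      linear_combination h2 + k z * hq
    rw [h3]; linarith
  have fx : ∀ z, hx (f z) = hx z - k z * (hx p - hx q) := fun z => hx_ofXY _ _
  have fy : ∀ z, hy (f z) = hy z - k z * (hy p - hy q) := fun z => hy_ofXY _ _
  have ft : ∀ z, ht (f z) = ht z - k z * (ht p - ht q) :=
    fun z => ht_ofXY_of_sq (hpos z) (hsq z)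
  have hlor : ∀ z w, lor (f z) (f w) = lor z w := fun z w => by
    have h1 := hk z
    have h2 := hk w
    unfold lor at h1 h2 ⊢
    rw [fx, fx, fy, fy, ft, ft]
    linear_combination k z * h2 + k w * h1 + k z * k w * (hp + hq)
  have hkf : ∀ z, k (f z) = - k z := fun z => by
    have h1 := hk (f z)
    have h2 := hk z
    refine mul_right_cancel₀ hne ?_
    rw [h1]
    unfold lor at h1 h2 ⊢
    rw [fx, fy, ft]
    linear_combination -h2 - k z * (hp + hq)
  have hff : ∀ z, f (f z) = z := fun z => by
    apply ext_hx_hy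
    · rw [fx, fx, hkf]; ring
    · rw [fy, fy, hkf]; ring
  refine ⟨isometryOfLor f f hff hlor, ?_, fun z hz => ?_⟩
  · have h1 : k p = 1 := by
      refine mul_right_cancel₀ hne ?_
      rw [hk, lor_self, one_mul]
    apply ext_hx_hy
    · exact (fx p).trans (by rw [h1]; ring)
    · exact (fy p).trans (by rw [h1]; ring)
  · have h1 : k z = 0 := by
      refine mul_right_cancel₀ hne ?_
      rw [hk, zero_mul, dist_eq_dist_iff.1 hz, sub_self]
    apply ext_hx_hy
    · exact (fx z).trans (by rw [h1]; ring)
    · exact (fy z).trans (by rw [h1]; ring)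

/-- Finite configurations of points with the same mutual distances are congruent. -/
theorem exists_isometry_of_dist_eq {ι : Type*} [Finite ι] (p q : ι → ℍ)
    (h : ∀ i j, dist (p i) (p j) = dist (q i) (q j)) : ∃ f : ℍ ≃ᵢ ℍ, ∀ i, f (p i) = q i := by
  classical
  have := Fintype.ofFinite ι
  have key : ∀ s : Finset ι, ∃ f : ℍ ≃ᵢ ℍ, ∀ i ∈ s, f (p i) = q i := by
    intro s
    induction s using Finset.induction_on with
    | empty => exact ⟨IsometryEquiv.refl ℍ, by simp⟩
    | insert a s _ ih =>
      obtain ⟨f, hf⟩ := ih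
      -- The points already matched are equidistant from `f (p a)` and `q a`, so the swap leaves
      -- them in place.
      obtain ⟨g, hg, hg'⟩ := exists_isometry_swap (f (p a)) (q a)
      refine ⟨f.trans g, fun i hi => ?_⟩
      rcases Finset.mem_insert.1 hi with rfl | hi
      · exact hg
      · change g (f (p i)) = q i
        rw [hf i hi]
        apply hg'
        rw [← hf i hi, f.dist_eq, h, hf i hi]
  obtain ⟨f, hf⟩ := key Finset.univ
  exact ⟨f, fun i => hf i (Finset.mem_univ i)⟩

/-! ### Explicit reflections and rotations, and their conjugates -/

theorem sq_of_orth {a b c d : ℝ} (h1 : a ^ 2 + c ^ 2 = 1) (h2 : b ^ 2 + d ^ 2 = 1)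
    (h3 : a * b + c * d = 0) (z : ℍ) :
    ht z ^ 2 = 1 + (a * hx z + b * hy z) ^ 2 + (c * hx z + d * hy z) ^ 2 := by
  have := ht_sq z
  linear_combination this - hx z ^ 2 * h1 - hy z ^ 2 * h2 - 2 * hx z * hy z * h3

theorem lor_orth {a b c d : ℝ} (h1 : a ^ 2 + c ^ 2 = 1) (h2 : b ^ 2 + d ^ 2 = 1)
    (h3 : a * b + c * d = 0) (z w : ℍ) :
    lor (ofXY (a * hx z + b * hy z) (c * hx z + d * hy z))
      (ofXY (a * hx w + b * hy w) (c * hx w + d * hy w)) = lor z w := by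
  unfold lor
  rw [ht_ofXY_of_sq (ht_pos z) (sq_of_orth h1 h2 h3 z),
    ht_ofXY_of_sq (ht_pos w) (sq_of_orth h1 h2 h3 w)]
  simp only [hx_ofXY, hy_ofXY]
  linear_combination (-hx z * hx w) * h1 - hy z * hy w * h2 -
    (hx z * hy w + hy z * hx w) * h3

/-- The isometry acting on the space-like coordinates by an orthogonal matrix. -/
def orthIsometry {a b c d : ℝ} (h1 : a ^ 2 + c ^ 2 = 1) (h2 : b ^ 2 + d ^ 2 = 1)
    (h3 : a * b + c * d = 0) (h4 : a ^ 2 + b ^ 2 = 1) (h5 : c ^ 2 + d ^ 2 = 1)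
    (h6 : a * c + b * d = 0) : ℍ ≃ᵢ ℍ :=
  isometryOfLor (fun z => ofXY (a * hx z + b * hy z) (c * hx z + d * hy z))
    (fun z => ofXY (a * hx z + c * hy z) (b * hx z + d * hy z))
    (fun z => by
      apply ext_hx_hy
      · simp only [hx_ofXY, hy_ofXY]; linear_combination hx z * h4 + hy z * h6
      · simp only [hx_ofXY, hy_ofXY]; linear_combination hx z * h6 + hy z * h5)
    (lor_orth h1 h2 h3)

/-- This is the geodesic through `ofXY 0 0` in the direction `(u, v)`, parametrized by arc length.
-/
theorem isometry_ofXY_sinh {u v : ℝ} (h : u ^ 2 + v ^ 2 = 1) :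
    Isometry fun t : ℝ => ofXY (u * Real.sinh t) (v * Real.sinh t) := by
  have hT : ∀ t, ht (ofXY (u * Real.sinh t) (v * Real.sinh t)) = Real.cosh t := fun t => by
    refine ht_ofXY_of_sq (Real.cosh_pos t) ?_
    have := Real.cosh_sq t
    linear_combination this - Real.sinh t ^ 2 * h
  refine Isometry.of_dist_eq fun s t => ?_
  have h1 : Real.cosh (dist (ofXY (u * Real.sinh s) (v * Real.sinh s))
      (ofXY (u * Real.sinh t) (v * Real.sinh t))) = Real.cosh (dist s t) := by
    rw [cosh_dist_eq_lor, Real.dist_eq, Real.cosh_abs, Real.cosh_sub]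
    unfold lor
    rw [hT, hT]
    simp only [hx_ofXY, hy_ofXY]
    linear_combination (-Real.sinh s * Real.sinh t) * h
  exact Real.cosh_strictMonoOn.injOn (mem_Ici.2 dist_nonneg) (mem_Ici.2 dist_nonneg) h1

/-- With `(u, v) = (cos θ, sin θ)` the entries are `cos 2θ` and `sin 2θ`, so the map is the
Euclidean reflection in the line spanned by `(u, v)`. The points fixed by it form the geodesic of
`isometry_ofXY_sinh`. -/
theorem exists_isReflection {u v : ℝ} (h : u ^ 2 + v ^ 2 = 1) :
    ∃ f : ℍ ≃ᵢ ℍ, IsReflection f ∧ ∀ z, f z = ofXY ((u ^ 2 - v ^ 2) * hx z + 2 * u * v * hy z)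
      (2 * u * v * hx z + (v ^ 2 - u ^ 2) * hy z) := by
  have h1 : (u ^ 2 - v ^ 2) ^ 2 + (2 * u * v) ^ 2 = 1 := by
    linear_combination (u ^ 2 + v ^ 2 + 1) * h
  refine ⟨orthIsometry (a := u ^ 2 - v ^ 2) (b := 2 * u * v) (c := 2 * u * v)
    (d := v ^ 2 - u ^ 2) h1 (by linear_combination h1) (by ring) h1 (by linear_combination h1)
    (by ring), ⟨_, isometry_ofXY_sinh h, ?_⟩, fun z => rfl⟩
  ext z
  constructor
  · rintro ⟨t, rfl⟩
    apply ext_hx_hy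
    · refine (hx_ofXY _ _).trans ?_
      simp only [hx_ofXY, hy_ofXY]
      linear_combination u * Real.sinh t * h
    · refine (hy_ofXY _ _).trans ?_
      simp only [hx_ofXY, hy_ofXY]
      linear_combination v * Real.sinh t * h
  · intro hz
    have e1 : (u ^ 2 - v ^ 2) * hx z + 2 * u * v * hy z = hx z := by
      have := congrArg hx (hz : _ = z)
      exact (hx_ofXY _ _).symm.trans this
    have e2 : 2 * u * v * hx z + (v ^ 2 - u ^ 2) * hy z = hy z := by
      have := congrArg hy (hz : _ = z)
      exact (hy_ofXY _ _).symm.trans this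
    refine ⟨Real.arsinh (u * hx z + v * hy z), ?_⟩
    simp only [Real.sinh_arsinh]
    apply ext_hx_hy
    · rw [hx_ofXY]; linear_combination e1 / 2 + hx z / 2 * h
    · rw [hy_ofXY]; linear_combination e2 / 2 + hy z / 2 * h

theorem exists_isRotation {c s : ℝ} (h : c ^ 2 + s ^ 2 = 1) (hc : c ≠ 1) :
    ∃ f : ℍ ≃ᵢ ℍ, IsRotation f ∧ ∀ z, f z = ofXY (c * hx z + (-s) * hy z)
      (s * hx z + c * hy z) := by
  refine ⟨orthIsometry (a := c) (b := -s) (c := s) (d := c) h (by linear_combination h) (by ring)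
    (by linear_combination h) (by linear_combination h) (by ring), ⟨ofXY 0 0, ?_⟩, fun z => rfl⟩
  ext z
  constructor
  · intro hz
    have e1 : c * hx z + (-s) * hy z = hx z := by
      have := congrArg hx (hz : _ = z)
      exact (hx_ofXY _ _).symm.trans this
    have e2 : s * hx z + c * hy z = hy z := by
      have := congrArg hy (hz : _ = z)
      exact (hy_ofXY _ _).symm.trans this
    have hc' : 1 - c ≠ 0 := sub_ne_zero.2 (Ne.symm hc)
    apply ext_hx_hy
    · rw [hx_ofXY]
      refine mul_left_cancel₀ hc' ?_
      linear_combination (c - 1) / 2 * e1 + s / 2 * e2 - hx z / 2 * h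
    · rw [hy_ofXY]
      refine mul_left_cancel₀ hc' ?_
      linear_combination (c - 1) / 2 * e2 - s / 2 * e1 - hy z / 2 * h
  · rintro rfl
    apply ext_hx_hy
    · refine (hx_ofXY _ _).trans ?_
      simp only [hx_ofXY, hy_ofXY]; ring
    · refine (hy_ofXY _ _).trans ?_
      simp only [hx_ofXY, hy_ofXY]; ring

theorem fixedPoints_conj (f g : ℍ ≃ᵢ ℍ) :
    Function.fixedPoints ((g.symm.trans f).trans g) = g '' Function.fixedPoints f := by
  ext z
  constructor
  · intro hz
    refine ⟨g.symm z, ?_, g.apply_symm_apply z⟩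
    have : g (f (g.symm z)) = z := hz
    have h2 := congrArg g.symm this
    rwa [g.symm_apply_apply] at h2
  · rintro ⟨w, hw, rfl⟩
    change g (f (g.symm (g w))) = g w
    rw [g.symm_apply_apply, hw]

theorem IsReflection.conj {f : ℍ ≃ᵢ ℍ} (hf : IsReflection f) (g : ℍ ≃ᵢ ℍ) :
    IsReflection ((g.symm.trans f).trans g) := by
  obtain ⟨l, hl, hr⟩ := hf
  refine ⟨g ∘ l, g.isometry.comp hl, ?_⟩
  rw [fixedPoints_conj, range_comp, hr]

theorem IsRotation.conj {f : ℍ ≃ᵢ ℍ} (hf : IsRotation f) (g : ℍ ≃ᵢ ℍ) :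
    IsRotation ((g.symm.trans f).trans g) := by
  obtain ⟨c, hc⟩ := hf
  exact ⟨g c, by rw [fixedPoints_conj, hc, image_singleton]⟩

/-- Symmetries of a quadrilateral are carried over by a congruence. -/
theorem Quad.conj_apply {p q : Quad} {g f : ℍ ≃ᵢ ℍ} (hg : ∀ i, g (p i) = q i)
    {σ : ZMod 4 → ZMod 4} (hf : ∀ i, f (p i) = p (σ i)) (i : ZMod 4) :
    ((g.symm.trans f).trans g) (q i) = q (σ i) := by
  change g (f (g.symm (q i))) = q (σ i)
  rw [← hg, g.symm_apply_apply, hf, hg]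

/-! ### Angles and the laws of cosines -/

/-- A positive multiple of `dir x y`, written as a linear function of the coordinates of `y` in the
hyperboloid model. -/
def tang (x y : ℍ) : ℂ :=
  ⟨hy y - x.re * (ht y - hx y),
    ((ht y + hx y) + (x.re ^ 2 - x.im ^ 2) * (ht y - hx y) - 2 * x.re * hy y) / (2 * x.im)⟩

/-- The factor `1 + lor x y` equals `|y - conj x|² / (2 * x.im * y.im)` and clears the denominator
in `dir`. -/
theorem tang_eq_smul (x y : ℍ) : tang x y = (1 + lor x y) • dir x y := by
  have h1 := x.im_pos
  have h2 := y.im_pos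
  have h3 : (y : ℂ) - (starRingEnd ℂ) (x : ℂ) ≠ 0 := by
    intro h
    have := congrArg Complex.im h
    simp at this
    linarith
  have h4 : (1 + lor x y : ℝ) = (((y : ℂ) - (starRingEnd ℂ) (x : ℂ)) *
      (starRingEnd ℂ) ((y : ℂ) - (starRingEnd ℂ) (x : ℂ))).re / (2 * x.im * y.im) := by
    unfold lor hx hy ht
    simp
    field_simp
    ring
  have h5 : ((1 + lor x y : ℝ) : ℂ) = (((y : ℂ) - (starRingEnd ℂ) (x : ℂ)) *
      (starRingEnd ℂ) ((y : ℂ) - (starRingEnd ℂ) (x : ℂ))) / ((2 * x.im * y.im : ℝ) : ℂ) := by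
    rw [h4, Complex.mul_conj]
    push_cast
    simp only [Complex.ofReal_re]
  have h6 : ((2 * x.im * y.im : ℝ) : ℂ) ≠ 0 := by
    rw [Complex.ofReal_ne_zero]; positivity
  rw [Complex.real_smul, h5]
  unfold dir
  have h7 : (((y : ℂ) - (starRingEnd ℂ) (x : ℂ)) *
      (starRingEnd ℂ) ((y : ℂ) - (starRingEnd ℂ) (x : ℂ))) / ((2 * x.im * y.im : ℝ) : ℂ) *
      (Complex.I * (((y : ℂ) - (x : ℂ)) / ((y : ℂ) - (starRingEnd ℂ) (x : ℂ)))) =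
      ((1 / (2 * x.im * y.im) : ℝ) : ℂ) * (Complex.I * (((y : ℂ) - (x : ℂ)) *
      (starRingEnd ℂ) ((y : ℂ) - (starRingEnd ℂ) (x : ℂ)))) := by
    rw [Complex.ofReal_div, Complex.ofReal_one]
    field_simp
  rw [h7]
  unfold tang hx hy ht
  apply Complex.ext
  · rw [Complex.re_ofReal_mul]
    simp
    field_simp
    ring
  · rw [Complex.im_ofReal_mul]
    simp
    field_simp
    ring

/-- Up to an isometry of tangent planes, `tang x y` is the projection `y - lor x y • x` of `y` to
the tangent plane at `x`, which explains the right-hand side. -/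
theorem inner_tang (x y z : ℍ) :
    inner ℝ (tang x y) (tang x z) = lor x y * lor x z - lor y z := by
  have h1 := x.im_pos
  have h2 := y.im_pos
  have h3 := z.im_pos
  rw [Complex.inner]
  simp only [Complex.mul_re, Complex.conj_re, Complex.conj_im]
  unfold tang lor hx hy ht
  field_simp
  ring

theorem angleAt_eq (x y z : ℍ) :
    angleAt x y z = InnerProductGeometry.angle (tang x y) (tang x z) := by
  have h1 := one_le_lor x y
  have h2 := one_le_lor x z
  rw [tang_eq_smul, tang_eq_smul, InnerProductGeometry.angle_smul_left_of_pos _ _ (by linarith),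
    InnerProductGeometry.angle_smul_right_of_pos _ _ (by linarith)]
  rfl

theorem angleAt_comm (x y z : ℍ) : angleAt x y z = angleAt x z y :=
  InnerProductGeometry.angle_comm _ _

/-- The hyperbolic sine of the distance. -/
def sh (x y : ℍ) : ℝ := √(lor x y ^ 2 - 1)

theorem sh_comm (x y : ℍ) : sh x y = sh y x := by
  unfold sh; rw [lor_comm]

theorem sh_sq (x y : ℍ) : sh x y ^ 2 = lor x y ^ 2 - 1 := by
  have := one_le_lor x y
  exact Real.sq_sqrt (by nlinarith)

theorem sh_pos {x y : ℍ} (h : x ≠ y) : 0 < sh x y := by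
  have := one_lt_lor h
  exact Real.sqrt_pos.2 (by nlinarith)

theorem norm_tang (x y : ℍ) : ‖tang x y‖ = sh x y := by
  rw [@norm_eq_sqrt_real_inner ℂ, inner_tang, lor_self, ← pow_two]
  rfl

theorem tang_ne_zero {x y : ℍ} (h : x ≠ y) : tang x y ≠ 0 := by
  rw [← norm_pos_iff, norm_tang]; exact sh_pos h

/-- The hyperbolic law of cosines. -/
theorem cos_angleAt_mul (x y z : ℍ) :
    Real.cos (angleAt x y z) * (sh x y * sh x z) = lor x y * lor x z - lor y z := by
  rw [angleAt_eq, ← norm_tang, ← norm_tang, InnerProductGeometry.cos_angle_mul_norm_mul_norm,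
    inner_tang]

theorem sin_angleAt_mul (x y z : ℍ) : Real.sin (angleAt x y z) * (sh x y * sh x z) =
    √(1 + 2 * lor x y * lor x z * lor y z - lor x y ^ 2 - lor x z ^ 2 - lor y z ^ 2) := by
  rw [angleAt_eq, ← norm_tang, ← norm_tang, InnerProductGeometry.sin_angle_mul_norm_mul_norm,
    inner_tang, inner_tang, inner_tang, lor_self, lor_self]
  congr 1; ring

/-- The hyperbolic law of cosines for the angles. -/
theorem lor_mul_sin_mul_sin {x y z : ℍ} (hxy : x ≠ y) (hyz : y ≠ z) (hxz : x ≠ z) :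
    lor y z * (Real.sin (angleAt y z x) * Real.sin (angleAt z x y)) =
      Real.cos (angleAt x y z) + Real.cos (angleAt y z x) * Real.cos (angleAt z x y) := by
  have a1 := cos_angleAt_mul x y z
  have b1 := cos_angleAt_mul y z x
  have c1 := cos_angleAt_mul z x y
  have b2 := sin_angleAt_mul y z x
  have c2 := sin_angleAt_mul z x y
  rw [sh_comm y x, lor_comm y x, lor_comm z x] at b1
  rw [sh_comm z x, sh_comm z y, lor_comm z x, lor_comm z y] at c1
  -- Both sines involve the square root of the same Gram determinant of `x, y, z`, so their product
  -- is rational in the products and the values of `sh`.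
  have hG : (1 + 2 * lor y z * lor y x * lor z x - lor y z ^ 2 - lor y x ^ 2 - lor z x ^ 2) =
      1 + 2 * lor x y * lor x z * lor y z - lor x y ^ 2 - lor x z ^ 2 - lor y z ^ 2 := by
    rw [lor_comm y x, lor_comm z x]; ring
  have hG' : (1 + 2 * lor z x * lor z y * lor x y - lor z x ^ 2 - lor z y ^ 2 - lor x y ^ 2) =
      1 + 2 * lor x y * lor x z * lor y z - lor x y ^ 2 - lor x z ^ 2 - lor y z ^ 2 := by
    rw [lor_comm z x, lor_comm z y]; ring
  rw [hG, sh_comm y x] at b2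
  rw [hG', sh_comm z x, sh_comm z y] at c2
  -- Nonnegativity of the Gram determinant is Cauchy–Schwarz for the two tangent vectors at `x`.
  have hG0 : 0 ≤ 1 + 2 * lor x y * lor x z * lor y z - lor x y ^ 2 - lor x z ^ 2 -
      lor y z ^ 2 := by
    have := real_inner_mul_inner_self_le (tang x y) (tang x z)
    rw [inner_tang, inner_tang, inner_tang, lor_self, lor_self] at this
    linarith
  have hGs := Real.sq_sqrt hG0
  have hyz2 := sh_sq y z
  have p1 := sh_pos hxy
  have p2 := sh_pos hyz
  have p3 := sh_pos hxz
  have hne : sh y z ^ 2 * (sh x y * sh x z) ≠ 0 := by positivity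
  refine mul_right_cancel₀ hne ?_
  have hss : Real.sin (angleAt y z x) * Real.sin (angleAt z x y) *
      (sh y z ^ 2 * (sh x y * sh x z)) = 1 + 2 * lor x y * lor x z * lor y z - lor x y ^ 2 -
      lor x z ^ 2 - lor y z ^ 2 := by
    rw [← hGs, pow_two (√_)]
    nth_rewrite 1 [← b2]
    rw [← c2]; ring
  have hcc : Real.cos (angleAt y z x) * Real.cos (angleAt z x y) *
      (sh y z ^ 2 * (sh x y * sh x z)) =
      (lor y z * lor x y - lor x z) * (lor x z * lor y z - lor x y) := by
    rw [lor_comm z x] at *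
    rw [← b1, ← c1]; ring
  have hca : Real.cos (angleAt x y z) * (sh y z ^ 2 * (sh x y * sh x z)) =
      (lor y z ^ 2 - 1) * (lor x y * lor x z - lor y z) := by
    rw [← a1, ← hyz2]; ring
  rw [add_mul, hcc, hca, mul_assoc, hss]
  ring

theorem angleAt_eq_of_dist {x y z x' y' z' : ℍ} (h1 : dist x y = dist x' y')
    (h2 : dist x z = dist x' z') (h3 : dist y z = dist y' z') :
    angleAt x y z = angleAt x' y' z' := by
  rw [dist_eq_dist_iff] at h1 h2 h3
  rw [angleAt_eq, angleAt_eq]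
  unfold InnerProductGeometry.angle
  rw [norm_tang, norm_tang, norm_tang, norm_tang, inner_tang, inner_tang]
  unfold sh
  rw [h1, h2, h3]

theorem angle_add_angle_of_smul_eq {u v w : ℂ} {a b c : ℝ} (ha : 0 < a) (hb : 0 < b) (hc : 0 < c)
    (hw : w ≠ 0) (h : b • v = a • u + c • w) :
    InnerProductGeometry.angle u w =
      InnerProductGeometry.angle u v + InnerProductGeometry.angle v w := by
  have hw' : c • w ≠ 0 := smul_ne_zero hc.ne' hw
  have := InnerProductGeometry.angle_eq_angle_add_add_angle_add (a • u) hw'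
  rw [← h, InnerProductGeometry.angle_smul_left_of_pos _ _ ha,
    InnerProductGeometry.angle_smul_right_of_pos _ _ hc,
    InnerProductGeometry.angle_smul_left_of_pos _ _ ha,
    InnerProductGeometry.angle_smul_right_of_pos _ _ hb,
    InnerProductGeometry.angle_smul_left_of_pos _ _ hc,
    InnerProductGeometry.angle_smul_right_of_pos _ _ hb, InnerProductGeometry.angle_comm w v]
    at this
  exact this

/-! ### Linear relations between vertices, and crossing diagonals -/

/-- A linear relation between four points in the hyperboloid model. -/
def IsRel (w x y z : ℍ) (a b c d : ℝ) : Prop :=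
  a * hx w + b * hx x + c * hx y + d * hx z = 0 ∧
  a * hy w + b * hy x + c * hy y + d * hy z = 0 ∧
  a * ht w + b * ht x + c * ht y + d * ht z = 0

/-- Four vectors in `ℝ³` are linearly dependent. -/
theorem exists_isRel (w x y z : ℍ) : ∃ a b c d : ℝ, IsRel w x y z a b c d ∧
    ¬(a = 0 ∧ b = 0 ∧ c = 0 ∧ d = 0) := by
  let v : Fin 4 → Fin 3 → ℝ := ![![hx w, hy w, ht w], ![hx x, hy x, ht x], ![hx y, hy y, ht y],
    ![hx z, hy z, ht z]]
  have hv : ¬ LinearIndependent ℝ v := fun h => by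
    have := h.fintype_card_le_finrank
    simp at this
  obtain ⟨g, hg, i, hi⟩ := Fintype.not_linearIndependent_iff.1 hv
  refine ⟨g 0, g 1, g 2, g 3, ⟨?_, ?_, ?_⟩, ?_⟩
  · simpa [Fin.sum_univ_four, v] using congrFun hg 0
  · simpa [Fin.sum_univ_four, v] using congrFun hg 1
  · simpa [Fin.sum_univ_four, v] using congrFun hg 2
  · rintro ⟨h0, h1, h2, h3⟩
    fin_cases i <;> contradiction

theorem IsRel.neg {w x y z : ℍ} {a b c d : ℝ} (h : IsRel w x y z a b c d) :
    IsRel w x y z (-a) (-b) (-c) (-d) := by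
  obtain ⟨h1, h2, h3⟩ := h
  exact ⟨by linarith, by linarith, by linarith⟩

theorem IsRel.rotate {w x y z : ℍ} {a b c d : ℝ} (h : IsRel w x y z a b c d) :
    IsRel x y z w b c d a := by
  obtain ⟨h1, h2, h3⟩ := h
  exact ⟨by linarith, by linarith, by linarith⟩

/-- Time-like coordinates are positive, so a relation with nonnegative coefficients is trivial. -/
theorem IsRel.eq_zero {w x y z : ℍ} {a b c d : ℝ} (h : IsRel w x y z a b c d)
    (ha : 0 ≤ a) (hb : 0 ≤ b) (hc : 0 ≤ c) (hd : 0 ≤ d) :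
    a = 0 ∧ b = 0 ∧ c = 0 ∧ d = 0 := by
  have h3 := h.2.2
  have a1 := mul_nonneg ha (ht_pos w).le
  have b1 := mul_nonneg hb (ht_pos x).le
  have c1 := mul_nonneg hc (ht_pos y).le
  have d1 := mul_nonneg hd (ht_pos z).le
  refine ⟨?_, ?_, ?_, ?_⟩
  · exact (mul_eq_zero_iff_right (ht_pos w).ne').1 (by linarith)
  · exact (mul_eq_zero_iff_right (ht_pos x).ne').1 (by linarith)
  · exact (mul_eq_zero_iff_right (ht_pos y).ne').1 (by linarith)
  · exact (mul_eq_zero_iff_right (ht_pos z).ne').1 (by linarith)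

theorem IsRel.mem_triangle {w x y z : ℍ} {a b c d : ℝ} (h : IsRel w x y z a b c d)
    (ha : a < 0) (hb : 0 ≤ b) (hc : 0 ≤ c) (hd : 0 ≤ d) : w ∈ triangle y x z := by
  obtain ⟨h1, h2, h3⟩ := h
  obtain ⟨e, rfl⟩ : ∃ e, a = -e := ⟨-a, by ring⟩
  have ha' : 0 < e := by linarith
  refine mem_triangle_of_eq (a := c / e) (b := b / e) (c := d / e) (by positivity)
    (by positivity) (by positivity) ?_ ?_ ?_ <;> field_simp <;> linarith

/-- Moving the nonpositive terms to the other side exhibits one vector in both cones; normalized, it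
is a common point of the two segments. -/
theorem IsRel.not_disjoint {w x y z : ℍ} {a b c d : ℝ} (h : IsRel w x y z a b c d)
    (ha : 0 ≤ a) (hb : 0 ≤ b) (hc : c ≤ 0) (hd : d ≤ 0) (hab : 0 < a + b) :
    ¬ Disjoint (seg w x) (seg y z) := by
  obtain ⟨h1, h2, h3⟩ := h
  obtain ⟨v, r, hr, e1, e2, e3⟩ := exists_pos_mul_eq w x ha hb hab
  refine not_disjoint_iff.2 ⟨v,
    mem_seg_of_eq (s := a / r) (t := b / r) (by positivity) (by positivity) ?_ ?_ ?_,
    mem_seg_of_eq (s := (-c) / r) (t := (-d) / r) (div_nonneg (by linarith) hr.le)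
      (div_nonneg (by linarith) hr.le) ?_ ?_ ?_⟩ <;> field_simp <;> linarith

/-- If no vertex of a simple quadrilateral is reflex, then its diagonals intersect. -/
theorem exists_diagonal_relation {w x y z : ℍ}
    (n1 : w ∉ triangle y x z) (n2 : x ∉ triangle z y w) (n3 : y ∉ triangle w z x)
    (n4 : z ∉ triangle x w y) (d1 : Disjoint (seg w x) (seg y z))
    (d2 : Disjoint (seg x y) (seg z w)) :
    ∃ a b c d : ℝ, IsRel w x y z a (-b) c (-d) ∧ 0 < a ∧ 0 < b ∧ 0 < c ∧ 0 < d := by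
  -- `P` excludes one coefficient against the other three (a reflex vertex), and `Q` two adjacent
  -- ones against the other two (opposite sides meeting). Both allow zeros.
  have P : ∀ {w x y z : ℍ} {a b c d : ℝ}, IsRel w x y z a b c d →
      ¬(a = 0 ∧ b = 0 ∧ c = 0 ∧ d = 0) → w ∉ triangle y x z →
      a ≤ 0 → 0 ≤ b → 0 ≤ c → 0 ≤ d → False := by
    intro w x y z a b c d h h0 hn ha hb hc hd
    rcases ha.lt_or_eq with ha | ha
    · exact hn (h.mem_triangle ha hb hc hd)
    · exact h0 (h.eq_zero ha.ge hb hc hd)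
  have Q : ∀ {w x y z : ℍ} {a b c d : ℝ}, IsRel w x y z a b c d →
      ¬(a = 0 ∧ b = 0 ∧ c = 0 ∧ d = 0) → Disjoint (seg w x) (seg y z) →
      0 ≤ a → 0 ≤ b → c ≤ 0 → d ≤ 0 → False := by
    intro w x y z a b c d h h0 hn ha hb hc hd
    rcases (add_nonneg ha hb).lt_or_eq with hab | hab
    · exact h.not_disjoint ha hb hc hd hab hn
    · have := h.neg.eq_zero (by linarith) (by linarith) (by linarith) (by linarith)
      exact h0 (by simpa using this)
  have key : ∀ a b c d : ℝ, IsRel w x y z a b c d → ¬(a = 0 ∧ b = 0 ∧ c = 0 ∧ d = 0) → 0 ≤ a →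
      0 < a ∧ b < 0 ∧ 0 < c ∧ d < 0 := by
    intro a b c d h h0 ha
    have h0' : ¬(-a = 0 ∧ -b = 0 ∧ -c = 0 ∧ -d = 0) := by simpa using h0
    have r1 := h.rotate
    have r2 := r1.rotate
    have r3 := r2.rotate
    have g0 := h.eq_zero
    have p1 := P h h0 n1
    have p2 := P r1 (fun k => h0 ⟨k.2.2.2, k.1, k.2.1, k.2.2.1⟩) n2
    have p3 := P r2 (fun k => h0 ⟨k.2.2.1, k.2.2.2, k.1, k.2.1⟩) n3
    have p4 := P r3 (fun k => h0 ⟨k.2.1, k.2.2.1, k.2.2.2, k.1⟩) n4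
    have p1' := P h.neg h0' n1
    have p2' := P r1.neg (fun k => h0' ⟨k.2.2.2, k.1, k.2.1, k.2.2.1⟩) n2
    have p3' := P r2.neg (fun k => h0' ⟨k.2.2.1, k.2.2.2, k.1, k.2.1⟩) n3
    have p4' := P r3.neg (fun k => h0' ⟨k.2.1, k.2.2.1, k.2.2.2, k.1⟩) n4
    have q1 := Q h h0 d1
    have q2 := Q r1 (fun k => h0 ⟨k.2.2.2, k.1, k.2.1, k.2.2.1⟩) d2
    have q1' := Q h.neg h0' d1
    have q2' := Q r1.neg (fun k => h0' ⟨k.2.2.2, k.1, k.2.1, k.2.2.1⟩) d2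
    simp only [Left.neg_nonpos_iff, Left.nonneg_neg_iff] at p1' p2' p3' p4' q1' q2'
    rcases le_total 0 b with hb | hb <;> rcases le_total 0 c with hc | hc <;>
      rcases le_total 0 d with hd | hd
    · exact (h0 (g0 ha hb hc hd)).elim
    · exact (p4 hd ha hb hc).elim
    · exact (p3 hc hd ha hb).elim
    · exact (q1 ha hb hc hd).elim
    · exact (p2 hb hc hd ha).elim
    -- In the alternating pattern no coefficient vanishes: with a zero, it would also count as one
    -- of the patterns excluded by `P`.
    · refine ⟨ha.lt_of_ne ?_, hb.lt_of_ne ?_, hc.lt_of_ne ?_, hd.lt_of_ne ?_⟩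
      · intro e; exact p3' hc hd e.ge hb
      · intro e; exact p4 hd ha e.ge hc
      · intro e; exact p1' ha hb e.ge hd
      · intro e; exact p2 hb hc e.ge ha
    · exact (q2' hb hc hd ha).elim
    · exact (p1' ha hb hc hd).elim
  obtain ⟨a, b, c, d, h, h0⟩ := exists_isRel w x y z
  rcases le_total 0 a with ha | ha
  · obtain ⟨k1, k2, k3, k4⟩ := key a b c d h h0 ha
    exact ⟨a, -b, c, -d, by simpa using h, k1, by linarith, k3, by linarith⟩
  · obtain ⟨k1, k2, k3, k4⟩ := key _ _ _ _ h.neg (by simpa using h0) (by linarith)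
    exact ⟨-a, b, -c, d, h.neg, k1, by linarith, k3, by linarith⟩

theorem tang_self (x : ℍ) : tang x x = 0 := by
  have : tang x x = (1 + lor x x) • dir x x := tang_eq_smul x x
  rw [this]; simp [dir]

theorem IsRel.tang_eq {w x y z : ℍ} {a b c d : ℝ} (h : IsRel w x y z a b c d) (o : ℍ) :
    a • tang o w + b • tang o x + c • tang o y + d • tang o z = 0 := by
  obtain ⟨h1, h2, h3⟩ := h
  have := o.im_pos.ne'
  apply Complex.ext
  · simp [tang]
    linear_combination h2 - o.re * (h3 - h1)
  · simp [tang]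
    field_simp
    linear_combination h3 + h1 + (o.re ^ 2 - o.im ^ 2) * (h3 - h1) - 2 * o.re * h2

/-- Seen from `w` the term of `w` drops out, so the direction of the diagonal `wy` is a positive
combination of the directions of the sides `wx` and `wz`. -/
theorem IsRel.angleAt_add {w x y z : ℍ} {a b c d : ℝ} (h : IsRel w x y z a (-b) c (-d))
    (hb : 0 < b) (hc : 0 < c) (hd : 0 < d) (hwz : w ≠ z) :
    angleAt w x z = angleAt w x y + angleAt w y z := by
  have := h.tang_eq w
  rw [tang_self] at this
  rw [angleAt_eq, angleAt_eq, angleAt_eq]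
  refine angle_add_angle_of_smul_eq hb hc hd (tang_ne_zero hwz) ?_
  rw [← sub_eq_zero, ← this]
  module

theorem angleAt_nonneg (x y z : ℍ) : 0 ≤ angleAt x y z := InnerProductGeometry.angle_nonneg _ _

theorem angleAt_le_pi (x y z : ℍ) : angleAt x y z ≤ Real.pi := InnerProductGeometry.angle_le_pi _ _

/-! ### Rigidity of `α`-quadrangles -/

/-- Two triangles on the same side, both with angle `α` opposite to it, cannot have the angles
`γ, δ` and `α - γ, α - δ` at this side if `γ + δ < α`. Here `L` is the hyperbolic cosine of the
length of the side. -/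
theorem not_add_lt {α L γ δ γ' δ' : ℝ} (hα : α < Real.pi / 2) (hL : 0 ≤ L) (hγ : 0 ≤ γ)
    (hδ : 0 ≤ δ) (h1 : γ + γ' = α) (h2 : δ + δ' = α)
    (e1 : L * (Real.sin γ * Real.sin δ) = Real.cos α + Real.cos γ * Real.cos δ)
    (e2 : L * (Real.sin γ' * Real.sin δ') = Real.cos α + Real.cos γ' * Real.cos δ') :
    ¬ γ + δ < α := by
  intro hlt
  -- If `γ + δ < α`, then `γ < δ'` and `δ < γ'`. Passing from `e1` to `e2`, the left side does not
  -- decrease while the right side strictly decreases.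
  have s1 : Real.sin γ ≤ Real.sin δ' :=
    Real.sin_le_sin_of_le_of_le_pi_div_two (by linarith) (by linarith) (by linarith)
  have s2 : Real.sin δ ≤ Real.sin γ' :=
    Real.sin_le_sin_of_le_of_le_pi_div_two (by linarith) (by linarith) (by linarith)
  have s3 : 0 ≤ Real.sin γ := Real.sin_nonneg_of_nonneg_of_le_pi hγ (by linarith)
  have s4 : 0 ≤ Real.sin δ := Real.sin_nonneg_of_nonneg_of_le_pi hδ (by linarith)
  have c1 : Real.cos δ' < Real.cos γ :=
    Real.cos_lt_cos_of_nonneg_of_le_pi hγ (by linarith) (by linarith)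
  have c2 : Real.cos γ' < Real.cos δ :=
    Real.cos_lt_cos_of_nonneg_of_le_pi hδ (by linarith) (by linarith)
  have c3 : 0 < Real.cos δ' := Real.cos_pos_of_mem_Ioo ⟨by linarith, by linarith⟩
  have c4 : 0 < Real.cos γ' := Real.cos_pos_of_mem_Ioo ⟨by linarith, by linarith⟩
  have m1 : Real.sin γ * Real.sin δ ≤ Real.sin δ' * Real.sin γ' := by gcongr; linarith
  have m2 : Real.cos δ' * Real.cos γ' < Real.cos γ * Real.cos δ := by gcongr
  have m3 := mul_le_mul_of_nonneg_left m1 hL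
  nlinarith

/-- At a reflex vertex the interior angle is at least `π`, which exceeds `α`. -/
theorem Quad.IsAlphaQuadrangle.notMem_triangle {α : ℝ} (hα : α < Real.pi / 2) {q : Quad}
    (h : q.IsAlphaQuadrangle α) (i : ZMod 4) :
    q i ∉ triangle (q (i + 2)) (q (i + 1)) (q (i + 3)) := by
  intro hm
  have := h.2 i
  unfold Quad.interiorAngle at this
  rw [if_pos hm] at this
  have h2 := angleAt_le_pi (q i) (q (i + 1)) (q (i + 3))
  have := Real.pi_pos
  linarith

theorem Quad.IsAlphaQuadrangle.angleAt_eq {α : ℝ} (hα : α < Real.pi / 2) {q : Quad}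
    (h : q.IsAlphaQuadrangle α) (i : ZMod 4) : angleAt (q i) (q (i + 1)) (q (i + 3)) = α := by
  have := h.2 i
  unfold Quad.interiorAngle at this
  rwa [if_neg (h.notMem_triangle hα i)] at this

/-- The side lengths and diagonals of an `α`-quadrangle are functions of the angle between the
first side and the diagonal. -/
theorem Quad.IsAlphaQuadrangle.lor_eq {α : ℝ} (hα : α ∈ Ioo 0 (Real.pi / 2)) {q : Quad}
    (h : q.IsAlphaQuadrangle α) {γ : ℝ} (hγ : angleAt (q 0) (q 1) (q 2) = γ) :
    γ ∈ Ioo 0 α ∧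
    lor (q 0) (q 1) * (Real.sin γ * Real.sin α) =
      Real.cos (α - γ) + Real.cos γ * Real.cos α ∧
    lor (q 1) (q 2) * (Real.sin α * Real.sin (α - γ)) =
      Real.cos γ + Real.cos α * Real.cos (α - γ) ∧
    lor (q 2) (q 3) * (Real.sin γ * Real.sin α) =
      Real.cos (α - γ) + Real.cos γ * Real.cos α ∧
    lor (q 3) (q 0) * (Real.sin α * Real.sin (α - γ)) =
      Real.cos γ + Real.cos α * Real.cos (α - γ) ∧
    lor (q 2) (q 0) * (Real.sin (α - γ) * Real.sin γ) =
      Real.cos α + Real.cos (α - γ) * Real.cos γ := by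
  obtain ⟨hα0, hα1⟩ := hα
  have hinj := h.1.injective
  have ne : ∀ i j : ZMod 4, i ≠ j → q i ≠ q j := fun i j hij => hinj.ne hij
  have a0 : angleAt (q 0) (q 1) (q 3) = α := h.angleAt_eq hα1 0
  have a1 : angleAt (q 1) (q 2) (q 0) = α := h.angleAt_eq hα1 1
  have a2 : angleAt (q 2) (q 3) (q 1) = α := h.angleAt_eq hα1 2
  have a3 : angleAt (q 3) (q 0) (q 2) = α := h.angleAt_eq hα1 3
  obtain ⟨a, b, c, d, hr, pa, pb, pc, pd⟩ := exists_diagonal_relation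
    (h.notMem_triangle hα1 0) (h.notMem_triangle hα1 1) (h.notMem_triangle hα1 2)
    (h.notMem_triangle hα1 3) (h.1.opposite 0) (h.1.opposite 1)
  have s0 : angleAt (q 0) (q 1) (q 3) = angleAt (q 0) (q 1) (q 2) + angleAt (q 0) (q 2) (q 3) :=
    hr.angleAt_add pb pc pd (ne 0 3 (by decide))
  have s2 : angleAt (q 2) (q 3) (q 1) = angleAt (q 2) (q 3) (q 0) + angleAt (q 2) (q 0) (q 1) :=
    hr.rotate.rotate.angleAt_add pd pa pb (ne 2 1 (by decide))
  have n1 := angleAt_nonneg (q 0) (q 1) (q 2)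
  have n2 := angleAt_nonneg (q 0) (q 2) (q 3)
  have n3 := angleAt_nonneg (q 2) (q 3) (q 0)
  have n4 := angleAt_nonneg (q 2) (q 0) (q 1)
  have l20 := lor_mul_sin_mul_sin (ne 1 2 (by decide)) (ne 2 0 (by decide)) (ne 1 0 (by decide))
  have l02 := lor_mul_sin_mul_sin (ne 3 0 (by decide)) (ne 0 2 (by decide)) (ne 3 2 (by decide))
  have l01 := lor_mul_sin_mul_sin (ne 2 0 (by decide)) (ne 0 1 (by decide)) (ne 2 1 (by decide))
  have l12 := lor_mul_sin_mul_sin (ne 0 1 (by decide)) (ne 1 2 (by decide)) (ne 0 2 (by decide))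
  have l23 := lor_mul_sin_mul_sin (ne 0 2 (by decide)) (ne 2 3 (by decide)) (ne 0 3 (by decide))
  have l30 := lor_mul_sin_mul_sin (ne 2 3 (by decide)) (ne 3 0 (by decide)) (ne 2 0 (by decide))
  have hL := one_le_lor (q 2) (q 0)
  rw [lor_comm (q 0) (q 2)] at l02
  rw [hγ] at *
  rw [a1] at *
  rw [a3] at *
  generalize angleAt (q 2) (q 0) (q 1) = δ at *
  generalize angleAt (q 0) (q 2) (q 3) = γ' at *
  generalize angleAt (q 2) (q 3) (q 0) = δ' at *
  -- The two triangles play symmetric roles: `k1` gives `γ + δ ≥ α`, and `k2`, applied to the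
  -- complementary angles, gives `γ + δ ≤ α`.
  have k1 : ¬ δ + γ < α :=
    not_add_lt (γ' := δ') (δ' := γ') hα1 (by linarith) n4 n1 (by linarith) (by linarith) l20 (by
      rw [mul_comm (Real.sin δ'), mul_comm (Real.cos δ')]; exact l02)
  have k2 : ¬ γ' + δ' < α :=
    not_add_lt (γ' := γ) (δ' := δ) hα1 (by linarith) n2 n3 (by linarith) (by linarith) l02 (by
      rw [mul_comm (Real.sin γ), mul_comm (Real.cos γ)]; exact l20)
  have e1 : δ = α - γ := by linarith
  have e2 : γ' = α - γ := by linarith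
  have e3 : δ' = γ := by linarith
  subst e1 e2 e3
  have hcα : 0 < Real.cos α := Real.cos_pos_of_mem_Ioo ⟨by linarith, hα1⟩
  refine ⟨⟨n1.lt_of_ne ?_, (sub_nonneg.1 n4).lt_of_ne ?_⟩, l01, l12, l23, l30, l20⟩
  -- At `γ = 0` or `γ = α` the left side of `l20` vanishes, while the right side is `2 cos α > 0`.
  · rintro rfl
    simp at l20
    linarith
  · rintro rfl
    simp at l20
    linarith

theorem dist_eq_of_lor_eq {p q : Quad} (h01 : lor (p 0) (p 1) = lor (q 0) (q 1))
    (h12 : lor (p 1) (p 2) = lor (q 1) (q 2)) (h23 : lor (p 2) (p 3) = lor (q 2) (q 3))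
    (h30 : lor (p 3) (p 0) = lor (q 3) (q 0)) (h20 : lor (p 2) (p 0) = lor (q 2) (q 0))
    (h13 : lor (p 1) (p 3) = lor (q 1) (q 3)) (i j : ZMod 4) :
    dist (p i) (p j) = dist (q i) (q j) := by
  have h10 := h01
  have h21 := h12
  have h32 := h23
  have h03 := h30
  have h02 := h20
  have h31 := h13
  rw [lor_comm, lor_comm (q _)] at h10 h21 h32 h03 h02 h31
  rw [dist_eq_dist_iff]
  fin_cases i <;> fin_cases j <;> first | exact (lor_self _).trans (lor_self _).symm | assumption

/-- An `α`-quadrangle is determined up to congruence by the angle between the first side and the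
diagonal. -/
theorem Quad.IsAlphaQuadrangle.congruent {α : ℝ} (hα : α ∈ Ioo 0 (Real.pi / 2)) {p q : Quad}
    (hp : p.IsAlphaQuadrangle α) (hq : q.IsAlphaQuadrangle α)
    (h : angleAt (p 0) (p 1) (p 2) = angleAt (q 0) (q 1) (q 2)) : p.Congruent q := by
  obtain ⟨hγ, p01, p12, p23, p30, p20⟩ := hp.lor_eq hα h
  obtain ⟨-, q01, q12, q23, q30, q20⟩ := hq.lor_eq hα rfl
  generalize angleAt (q 0) (q 1) (q 2) = γ at *
  have s1 : 0 < Real.sin γ := Real.sin_pos_of_pos_of_lt_pi hγ.1 (by linarith [hγ.2, hα.2, hα.1])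
  have s2 : 0 < Real.sin α := Real.sin_pos_of_pos_of_lt_pi hα.1 (by linarith [hα.1, hα.2])
  have s3 : 0 < Real.sin (α - γ) := Real.sin_pos_of_pos_of_lt_pi (by linarith [hγ.2])
    (by linarith [hγ.1, hα.1, hα.2])
  have e01 : lor (p 0) (p 1) = lor (q 0) (q 1) :=
    mul_right_cancel₀ (by positivity) (p01.trans q01.symm)
  have e12 : lor (p 1) (p 2) = lor (q 1) (q 2) :=
    mul_right_cancel₀ (by positivity) (p12.trans q12.symm)
  have e23 : lor (p 2) (p 3) = lor (q 2) (q 3) :=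
    mul_right_cancel₀ (by positivity) (p23.trans q23.symm)
  have e30 : lor (p 3) (p 0) = lor (q 3) (q 0) :=
    mul_right_cancel₀ (by positivity) (p30.trans q30.symm)
  have e20 : lor (p 2) (p 0) = lor (q 2) (q 0) :=
    mul_right_cancel₀ (by positivity) (p20.trans q20.symm)
  -- The other diagonal follows from the two sides at `p 0` and the angle `α` between them.
  have e13 : lor (p 1) (p 3) = lor (q 1) (q 3) := by
    have c1 := cos_angleAt_mul (p 0) (p 1) (p 3)
    have c2 := cos_angleAt_mul (q 0) (q 1) (q 3)
    have a1 : angleAt (p 0) (p 1) (p 3) = α := hp.angleAt_eq hα.2 0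
    have a2 : angleAt (q 0) (q 1) (q 3) = α := hq.angleAt_eq hα.2 0
    unfold sh at c1 c2
    rw [a1, lor_comm _ (p 3), e01, e30] at c1
    rw [a2, lor_comm _ (q 3)] at c2
    linarith
  exact exists_isometry_of_dist_eq p q (dist_eq_of_lor_eq e01 e12 e23 e30 e20 e13)

/-- Squaring the law of cosines removes the square roots in `sh`; `hN` restores the sign of the
cosine. -/
theorem angleAt_eq_of_sq {w u v : ℍ} {θ : ℝ} (hθ : θ ∈ Ioo 0 (Real.pi / 2)) (hu : w ≠ u)
    (hv : w ≠ v) (hN : 0 < lor w u * lor w v - lor u v)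
    (h : Real.cos θ ^ 2 * ((lor w u ^ 2 - 1) * (lor w v ^ 2 - 1)) =
      (lor w u * lor w v - lor u v) ^ 2) : angleAt w u v = θ := by
  have hs : 0 < sh w u * sh w v := mul_pos (sh_pos hu) (sh_pos hv)
  have hc : 0 < Real.cos θ := Real.cos_pos_of_mem_Ioo ⟨by linarith [hθ.1, hθ.2], hθ.2⟩
  refine Real.injOn_cos ⟨angleAt_nonneg _ _ _, angleAt_le_pi _ _ _⟩
    ⟨hθ.1.le, by linarith [hθ.1, hθ.2]⟩ (mul_right_cancel₀ hs.ne' ?_)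
  rw [cos_angleAt_mul, ← sq_eq_sq₀ hN.le (by positivity), ← h, mul_pow, mul_pow, sh_sq, sh_sq]

/-! ### Centred rectangles: distances, simplicity and angles -/

/-- The quadrilateral whose vertices have space-like coordinates `(±x, ±y)`. -/
def rect (x y : ℝ) : Quad :=
  (![ofXY x y, ofXY (-x) y, ofXY (-x) (-y), ofXY x (-y)] : Fin 4 → ℍ)

theorem rect_zero (x y : ℝ) : rect x y 0 = ofXY x y := rfl

theorem rect_one (x y : ℝ) : rect x y 1 = ofXY (-x) y := rfl

theorem rect_two (x y : ℝ) : rect x y 2 = ofXY (-x) (-y) := rfl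

theorem rect_three (x y : ℝ) : rect x y 3 = ofXY x (-y) := rfl

theorem forall_zmod_four {P : ZMod 4 → Prop} (h0 : P 0) (h1 : P 1) (h2 : P 2) (h3 : P 3) :
    ∀ i, P i := by
  intro i
  fin_cases i <;> assumption

/-- As `cosh a = 1 + 2 sinh² (a/2)`, the coordinate `x` is the hyperbolic sine of half the side. -/
theorem lor_ofXY_neg_left (x y : ℝ) : lor (ofXY x y) (ofXY (-x) y) = 1 + 2 * x ^ 2 := by
  have : √(1 + x ^ 2 + y ^ 2) ^ 2 = 1 + x ^ 2 + y ^ 2 := Real.sq_sqrt (by positivity)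
  unfold lor
  simp only [ht_ofXY, hx_ofXY, hy_ofXY, neg_sq]
  linear_combination this

theorem lor_ofXY_neg_right (x y : ℝ) : lor (ofXY x y) (ofXY x (-y)) = 1 + 2 * y ^ 2 := by
  have : √(1 + x ^ 2 + y ^ 2) ^ 2 = 1 + x ^ 2 + y ^ 2 := Real.sq_sqrt (by positivity)
  unfold lor
  simp only [ht_ofXY, hx_ofXY, hy_ofXY, neg_sq]
  linear_combination this

theorem lor_ofXY_neg_neg (x y : ℝ) :
    lor (ofXY x y) (ofXY (-x) (-y)) = 1 + 2 * x ^ 2 + 2 * y ^ 2 := by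
  have : √(1 + x ^ 2 + y ^ 2) ^ 2 = 1 + x ^ 2 + y ^ 2 := Real.sq_sqrt (by positivity)
  unfold lor
  simp only [ht_ofXY, hx_ofXY, hy_ofXY, neg_sq]
  linear_combination this

theorem lor_rect_01 (x y : ℝ) : lor (rect x y 0) (rect x y 1) = 1 + 2 * x ^ 2 :=
  lor_ofXY_neg_left x y

theorem lor_rect_12 (x y : ℝ) : lor (rect x y 1) (rect x y 2) = 1 + 2 * y ^ 2 :=
  lor_ofXY_neg_right (-x) y

theorem lor_rect_23 (x y : ℝ) : lor (rect x y 2) (rect x y 3) = 1 + 2 * x ^ 2 := by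
  have := lor_ofXY_neg_left (-x) (-y)
  rwa [neg_neg, neg_sq] at this

theorem lor_rect_30 (x y : ℝ) : lor (rect x y 3) (rect x y 0) = 1 + 2 * y ^ 2 := by
  have := lor_ofXY_neg_right x (-y)
  rwa [neg_neg, neg_sq] at this

theorem lor_rect_20 (x y : ℝ) : lor (rect x y 2) (rect x y 0) = 1 + 2 * x ^ 2 + 2 * y ^ 2 := by
  rw [lor_comm]
  exact lor_ofXY_neg_neg x y

theorem lor_rect_13 (x y : ℝ) : lor (rect x y 1) (rect x y 3) = 1 + 2 * x ^ 2 + 2 * y ^ 2 := by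
  have := lor_ofXY_neg_neg (-x) y
  rwa [neg_neg, neg_sq] at this

theorem lor_rect_cases (x y : ℝ) (i j : ZMod 4) (hij : i ≠ j) :
    lor (rect x y i) (rect x y j) = 1 + 2 * x ^ 2 ∨
    lor (rect x y i) (rect x y j) = 1 + 2 * y ^ 2 ∨
    lor (rect x y i) (rect x y j) = 1 + 2 * x ^ 2 + 2 * y ^ 2 := by
  have h01 := lor_rect_01 x y
  have h12 := lor_rect_12 x y
  have h23 := lor_rect_23 x y
  have h30 := lor_rect_30 x y
  have h20 := lor_rect_20 x y
  have h13 := lor_rect_13 x y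
  have h10 := h01
  have h21 := h12
  have h32 := h23
  have h03 := h30
  have h02 := h20
  have h31 := h13
  rw [lor_comm] at h10 h21 h32 h03 h02 h31
  fin_cases i <;> fin_cases j <;> first
    | exact (hij rfl).elim
    | exact Or.inl ‹_›
    | exact Or.inr (Or.inl ‹_›)
    | exact Or.inr (Or.inr ‹_›)

theorem rect_injective {x y : ℝ} (hx0 : 0 < x) (hy0 : 0 < y) :
    Function.Injective (rect x y) := by
  intro i j h
  by_contra hij
  have h1 := lor_rect_cases x y i j hij
  rw [h, lor_self] at h1
  have := pow_pos hx0 2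
  have := pow_pos hy0 2
  rcases h1 with h1 | h1 | h1 <;> linarith

theorem seg_comm (x y : ℍ) : seg x y = seg y x := by
  unfold seg
  ext z
  simp only [mem_ofPred_eq]
  rw [dist_comm x z, dist_comm z y, dist_comm x y, add_comm]

/-- For a common point, with coefficients `s, t` on `AB` and `s', t'` on `BC`, the coordinates `hx`
and `ht` give `t - s = s' + t' = s + t`. So `s = 0`, and normalization gives `t = 1`. -/
theorem seg_inter_seg {A B C : ℍ} (h1 : hx A = -hx B) (h2 : hy A = hy B) (h3 : hx C = hx B)
    (h4 : hy C = -hy B) (h5 : ht A = ht B) (h6 : ht C = ht B) (hX : hx B ≠ 0) (hY : hy B ≠ 0) :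
    seg A B ∩ seg B C = {B} := by
  ext z
  constructor
  · rintro ⟨hz1, hz2⟩
    obtain ⟨s, t, hs, ht0, e1, e2, e3⟩ := exists_of_mem_seg hz1
    obtain ⟨s', t', hs', ht0', f1, f2, f3⟩ := exists_of_mem_seg hz2
    rw [h1] at e1
    rw [h2] at e2
    rw [h5] at e3
    rw [h3] at f1
    rw [h4] at f2
    rw [h6] at f3
    have k1 : t - s = s' + t' := mul_right_cancel₀ hX (by linarith)
    have k3 : s + t = s' + t' := mul_right_cancel₀ (ht_pos B).ne' (by linarith)
    have ks : s = 0 := by linarith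
    subst ks
    have hz := ht_sq z
    have hB := ht_sq B
    have : t ^ 2 = 1 ^ 2 := by
      rw [e1, e2, e3] at hz
      linear_combination hz - t ^ 2 * hB
    have ht1 : t = 1 := (sq_eq_sq₀ ht0 zero_le_one).1 this
    subst ht1
    exact ext_hx_hy (by linarith) (by linarith)
  · rintro rfl
    exact ⟨by simp [seg], by simp [seg]⟩

/-- The coordinate `f` is linear, so it separates the two cones. -/
theorem disjoint_seg {f : ℍ → ℝ} (hf : f = hx ∨ f = hy) {A B C D : ℍ} (hA : 0 < f A)
    (hB : 0 < f B) (hC : f C < 0) (hD : f D < 0) : Disjoint (seg A B) (seg C D) := by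
  refine disjoint_left.2 fun z hz1 hz2 => ?_
  obtain ⟨s, t, hs, ht0, e1, e2, e3⟩ := exists_of_mem_seg hz1
  obtain ⟨s', t', hs', ht0', f1, f2, -⟩ := exists_of_mem_seg hz2
  have k1 : f z = s * f A + t * f B := by rcases hf with rfl | rfl <;> assumption
  have k2 : f z = s' * f C + t' * f D := by rcases hf with rfl | rfl <;> assumption
  have m1 := mul_nonneg hs hA.le
  have m2 := mul_nonneg ht0 hB.le
  have m3 := mul_nonpos_of_nonneg_of_nonpos hs' hC.le
  have m4 := mul_nonpos_of_nonneg_of_nonpos ht0' hD.le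
  have n1 : s = 0 := (mul_eq_zero_iff_right hA.ne').1 (by linarith)
  have n2 : t = 0 := (mul_eq_zero_iff_right hB.ne').1 (by linarith)
  have := ht_pos z
  rw [e3, n1, n2] at this
  simp at this

/-- Adding the equations for the two coordinates, each divided by that of `w`, gives `2 = -2a` with
`a ≥ 0`. -/
theorem notMem_triangle_of_rect {w o u v : ℍ} (o1 : hx o = -hx w) (o2 : hy o = -hy w)
    (u1 : hx u = -hx w) (u2 : hy u = hy w) (v1 : hx v = hx w) (v2 : hy v = -hy w)
    (hX : hx w ≠ 0) (hY : hy w ≠ 0) :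
    w ∉ triangle o u v ∧ w ∉ triangle o v u := by
  have key : ∀ a b c : ℝ, 0 ≤ a → 0 ≤ b → 0 ≤ c → hx w = a * hx o + b * hx u + c * hx v →
      hy w = a * hy o + b * hy u + c * hy v → False := by
    intro a b c ha hb hc e1 e2
    rw [o1, u1, v1] at e1
    rw [o2, u2, v2] at e2
    have k1 : 1 = -a - b + c := mul_right_cancel₀ hX (by linarith)
    have k2 : 1 = -a + b - c := mul_right_cancel₀ hY (by linarith)
    linarith
  constructor
  · intro h
    obtain ⟨a, b, c, ha, hb, hc, e1, e2, -⟩ := exists_of_mem_triangle h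
    exact key a b c ha hb hc e1 e2
  · intro h
    obtain ⟨a, b, c, ha, hb, hc, e1, e2, -⟩ := exists_of_mem_triangle h
    exact key a c b ha hc hb (by linarith) (by linarith)

theorem rect_isSimple {x y : ℝ} (hx0 : 0 < x) (hy0 : 0 < y) : (rect x y).IsSimple where
  injective := rect_injective hx0 hy0
  adjacent := by
    refine forall_zmod_four ?_ ?_ ?_ ?_
    · change seg (rect x y 0) (rect x y 1) ∩ seg (rect x y 1) (rect x y 2) = {rect x y 1}
      apply seg_inter_seg <;>
        simp [rect_zero, rect_one, rect_two, hx_ofXY, hy_ofXY, ht_ofXY, hx0.ne', hy0.ne']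
    · change seg (rect x y 1) (rect x y 2) ∩ seg (rect x y 2) (rect x y 3) = {rect x y 2}
      rw [inter_comm, seg_comm, seg_comm (rect x y 1)]
      apply seg_inter_seg <;>
        simp [rect_three, rect_one, rect_two, hx_ofXY, hy_ofXY, ht_ofXY, hx0.ne', hy0.ne']
    · change seg (rect x y 2) (rect x y 3) ∩ seg (rect x y 3) (rect x y 0) = {rect x y 3}
      apply seg_inter_seg <;>
        simp [rect_three, rect_zero, rect_two, hx_ofXY, hy_ofXY, ht_ofXY, hx0.ne', hy0.ne']
    · change seg (rect x y 3) (rect x y 0) ∩ seg (rect x y 0) (rect x y 1) = {rect x y 0}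
      rw [inter_comm, seg_comm, seg_comm (rect x y 3)]
      apply seg_inter_seg <;>
        simp [rect_three, rect_one, rect_zero, hx_ofXY, hy_ofXY, ht_ofXY, hx0.ne', hy0.ne']
  opposite := by
    have h1 : Disjoint (seg (rect x y 0) (rect x y 1)) (seg (rect x y 2) (rect x y 3)) := by
      apply disjoint_seg (f := hy) (Or.inr rfl) <;>
        simpa [rect_zero, rect_one, rect_two, rect_three, hx_ofXY, hy_ofXY]
    have h2 : Disjoint (seg (rect x y 3) (rect x y 0)) (seg (rect x y 1) (rect x y 2)) := by
      apply disjoint_seg (f := hx) (Or.inl rfl) <;>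
        simpa [rect_zero, rect_one, rect_two, rect_three, hx_ofXY, hy_ofXY]
    exact forall_zmod_four h1 h2.symm h1.symm h2

/-- The hypothesis `h` is the squared law of cosines for sides `1 + 2x²`, `1 + 2y²` and diagonal `1
+ 2x² + 2y²`, after cancelling `16x²y²`. -/
theorem rect_interiorAngle {x y : ℝ} (hx0 : 0 < x) (hy0 : 0 < y) {α : ℝ}
    (hα : α ∈ Ioo 0 (Real.pi / 2))
    (h : Real.cos α ^ 2 * ((1 + x ^ 2) * (1 + y ^ 2)) = x ^ 2 * y ^ 2) (i : ZMod 4) :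
    (rect x y).interiorAngle i = α := by
  have key : ∀ w u v : ℍ, lor w u = 1 + 2 * x ^ 2 → lor w v = 1 + 2 * y ^ 2 →
      lor u v = 1 + 2 * x ^ 2 + 2 * y ^ 2 → angleAt w u v = α := by
    intro w u v e1 e2 e3
    have hN : lor w u * lor w v - lor u v = 4 * x ^ 2 * y ^ 2 := by rw [e1, e2, e3]; ring
    refine angleAt_eq_of_sq hα ?_ ?_ ?_ ?_
    · rintro rfl
      rw [lor_self] at e1
      nlinarith
    · rintro rfl
      rw [lor_self] at e2
      nlinarith
    · rw [hN]; positivity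
    · rw [hN, e1, e2]
      linear_combination 16 * x ^ 2 * y ^ 2 * h
  have n : ∀ i, rect x y i ∉ triangle (rect x y (i + 2)) (rect x y (i + 1)) (rect x y (i + 3)) := by
    refine forall_zmod_four ?_ ?_ ?_ ?_
    · change rect x y 0 ∉ triangle (rect x y 2) (rect x y 1) (rect x y 3)
      refine (notMem_triangle_of_rect ?_ ?_ ?_ ?_ ?_ ?_ ?_ ?_).1 <;>
        simp [rect_zero, rect_one, rect_two, rect_three, hx_ofXY, hy_ofXY, hx0.ne', hy0.ne']
    · change rect x y 1 ∉ triangle (rect x y 3) (rect x y 2) (rect x y 0)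
      refine (notMem_triangle_of_rect ?_ ?_ ?_ ?_ ?_ ?_ ?_ ?_).2 <;>
        simp [rect_zero, rect_one, rect_two, rect_three, hx_ofXY, hy_ofXY, hx0.ne', hy0.ne']
    · change rect x y 2 ∉ triangle (rect x y 0) (rect x y 3) (rect x y 1)
      refine (notMem_triangle_of_rect ?_ ?_ ?_ ?_ ?_ ?_ ?_ ?_).1 <;>
        simp [rect_zero, rect_one, rect_two, rect_three, hx_ofXY, hy_ofXY, hx0.ne', hy0.ne']
    · change rect x y 3 ∉ triangle (rect x y 1) (rect x y 0) (rect x y 2)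
      refine (notMem_triangle_of_rect ?_ ?_ ?_ ?_ ?_ ?_ ?_ ?_).2 <;>
        simp [rect_zero, rect_one, rect_two, rect_three, hx_ofXY, hy_ofXY, hx0.ne', hy0.ne']
  have a : ∀ i, angleAt (rect x y i) (rect x y (i + 1)) (rect x y (i + 3)) = α := by
    have h01 := lor_rect_01 x y
    have h12 := lor_rect_12 x y
    have h23 := lor_rect_23 x y
    have h30 := lor_rect_30 x y
    have h20 := lor_rect_20 x y
    have h13 := lor_rect_13 x y
    refine forall_zmod_four ?_ ?_ ?_ ?_
    · exact key _ _ _ h01 ((lor_comm _ _).trans h30) h13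
    · exact (angleAt_comm _ _ _).trans
        (key _ _ _ ((lor_comm _ _).trans h01) h12 ((lor_comm _ _).trans h20))
    · exact key _ _ _ h23 ((lor_comm _ _).trans h12) ((lor_comm _ _).trans h13)
    · exact (angleAt_comm _ _ _).trans (key _ _ _ ((lor_comm _ _).trans h23) h30 h20)
  unfold Quad.interiorAngle
  rw [if_neg (n i), a i]

theorem rect_angleAt_diagonal {x y : ℝ} (hx0 : 0 < x) (hy0 : 0 < y) {γ : ℝ}
    (hγ : γ ∈ Ioo 0 (Real.pi / 2))
    (h : Real.cos γ ^ 2 * ((1 + x ^ 2) * (x ^ 2 + y ^ 2)) = x ^ 2 * (1 + x ^ 2 + y ^ 2)) :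
    angleAt (rect x y 0) (rect x y 1) (rect x y 2) = γ := by
  have hinj := rect_injective hx0 hy0
  have h01 := lor_rect_01 x y
  have h12 := lor_rect_12 x y
  have h20 := lor_rect_20 x y
  have hN : lor (rect x y 0) (rect x y 1) * lor (rect x y 0) (rect x y 2) -
      lor (rect x y 1) (rect x y 2) = 4 * x ^ 2 * (1 + x ^ 2 + y ^ 2) := by
    rw [h01, h12, lor_comm, h20]; ring
  refine angleAt_eq_of_sq hγ (hinj.ne (by decide)) (hinj.ne (by decide)) ?_ ?_
  · rw [hN]; positivity
  · rw [hN, h01, lor_comm (rect x y 0) (rect x y 2), h20]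
    linear_combination 16 * x ^ 2 * (1 + x ^ 2 + y ^ 2) * h

/-! ### Symmetries of rectangles and squares -/

theorem exists_reflection_matrix {c s u v : ℝ} (h : u ^ 2 + v ^ 2 = 1) (hc : u ^ 2 - v ^ 2 = c)
    (hs : 2 * u * v = s) : ∃ f : ℍ ≃ᵢ ℍ, IsReflection f ∧
      ∀ x y, f (ofXY x y) = ofXY (c * x + s * y) (s * x - c * y) := by
  obtain ⟨f, hf, hf'⟩ := exists_isReflection h
  refine ⟨f, hf, fun x y => ?_⟩
  rw [hf', hx_ofXY, hy_ofXY, ← hc, ← hs]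
  congr 1
  ring

theorem exists_rotation_matrix {c s : ℝ} (h : c ^ 2 + s ^ 2 = 1) (hc : c ≠ 1) :
    ∃ f : ℍ ≃ᵢ ℍ, IsRotation f ∧ ∀ x y, f (ofXY x y) = ofXY (c * x - s * y) (s * x + c * y) := by
  obtain ⟨f, hf, hf'⟩ := exists_isRotation h hc
  refine ⟨f, hf, fun x y => ?_⟩
  rw [hf', hx_ofXY, hy_ofXY]
  congr 1
  ring

theorem rect_reflection_one (x y : ℝ) :
    ∃ f : ℍ ≃ᵢ ℍ, IsReflection f ∧ ∀ i, f (rect x y i) = rect x y (1 - i) := by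
  obtain ⟨f, hf, h⟩ := exists_reflection_matrix (c := -1) (s := 0) (u := 0) (v := 1)
    (by norm_num) (by norm_num) (by norm_num)
  refine ⟨f, hf, forall_zmod_four ?_ ?_ ?_ ?_⟩ <;>
    (change f (ofXY _ _) = ofXY _ _; rw [h]; congr 1 <;> ring)

theorem rect_reflection_three (x y : ℝ) :
    ∃ f : ℍ ≃ᵢ ℍ, IsReflection f ∧ ∀ i, f (rect x y i) = rect x y (3 - i) := by
  obtain ⟨f, hf, h⟩ := exists_reflection_matrix (c := 1) (s := 0) (u := 1) (v := 0)
    (by norm_num) (by norm_num) (by norm_num)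
  refine ⟨f, hf, forall_zmod_four ?_ ?_ ?_ ?_⟩ <;>
    (change f (ofXY _ _) = ofXY _ _; rw [h]; congr 1 <;> ring)

theorem rect_rotation_two (x y : ℝ) :
    ∃ f : ℍ ≃ᵢ ℍ, IsRotation f ∧ ∀ i, f (rect x y i) = rect x y (i + 2) := by
  obtain ⟨f, hf, h⟩ := exists_rotation_matrix (c := -1) (s := 0) (by norm_num) (by norm_num)
  refine ⟨f, hf, forall_zmod_four ?_ ?_ ?_ ?_⟩ <;>
    (change f (ofXY _ _) = ofXY _ _; rw [h]; congr 1 <;> ring)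

theorem rect_hasRectangleSymmetries (x y : ℝ) : (rect x y).HasRectangleSymmetries :=
  ⟨rect_reflection_one x y, rect_reflection_three x y, rect_rotation_two x y⟩

theorem rect_reflection_zero (x : ℝ) :
    ∃ f : ℍ ≃ᵢ ℍ, IsReflection f ∧ ∀ i, f (rect x x i) = rect x x (0 - i) := by
  have h2 : √(1 / 2) ^ 2 = (1 / 2 : ℝ) := Real.sq_sqrt (by norm_num)
  obtain ⟨f, hf, h⟩ := exists_reflection_matrix (c := 0) (s := 1) (u := √(1 / 2)) (v := √(1 / 2))
    (by linarith) (by linarith) (by linarith)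
  refine ⟨f, hf, forall_zmod_four ?_ ?_ ?_ ?_⟩ <;>
    (change f (ofXY _ _) = ofXY _ _; rw [h]; congr 1 <;> ring)

theorem rect_reflection_two (x : ℝ) :
    ∃ f : ℍ ≃ᵢ ℍ, IsReflection f ∧ ∀ i, f (rect x x i) = rect x x (2 - i) := by
  have h2 : √(1 / 2) ^ 2 = (1 / 2 : ℝ) := Real.sq_sqrt (by norm_num)
  obtain ⟨f, hf, h⟩ := exists_reflection_matrix (c := 0) (s := -1) (u := √(1 / 2))
    (v := -√(1 / 2)) (by linarith) (by linarith) (by linarith)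
  refine ⟨f, hf, forall_zmod_four ?_ ?_ ?_ ?_⟩ <;>
    (change f (ofXY _ _) = ofXY _ _; rw [h]; congr 1 <;> ring)

theorem rect_rotation_one (x : ℝ) :
    ∃ f : ℍ ≃ᵢ ℍ, IsRotation f ∧ ∀ i, f (rect x x i) = rect x x (i + 1) := by
  obtain ⟨f, hf, h⟩ := exists_rotation_matrix (c := 0) (s := 1) (by norm_num) (by norm_num)
  refine ⟨f, hf, forall_zmod_four ?_ ?_ ?_ ?_⟩ <;>
    (change f (ofXY _ _) = ofXY _ _; rw [h]; congr 1 <;> ring)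

theorem rect_rotation_three (x : ℝ) :
    ∃ f : ℍ ≃ᵢ ℍ, IsRotation f ∧ ∀ i, f (rect x x i) = rect x x (i + 3) := by
  obtain ⟨f, hf, h⟩ := exists_rotation_matrix (c := 0) (s := -1) (by norm_num) (by norm_num)
  refine ⟨f, hf, forall_zmod_four ?_ ?_ ?_ ?_⟩ <;>
    (change f (ofXY _ _) = ofXY _ _; rw [h]; congr 1 <;> ring)

theorem rect_hasSquareSymmetries (x : ℝ) : (rect x x).HasSquareSymmetries :=
  ⟨forall_zmod_four (rect_reflection_zero x) (rect_reflection_one x x) (rect_reflection_two x)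
    (rect_reflection_three x x), forall_zmod_four (fun h => (h rfl).elim)
    (fun _ => rect_rotation_one x) (fun _ => rect_rotation_two x x)
    (fun _ => rect_rotation_three x)⟩

/-! ### Transport of symmetries, and unlabelled congruence -/

theorem Quad.Congruent.hasRectangleSymmetries {p q : Quad} (h : p.Congruent q)
    (hp : p.HasRectangleSymmetries) : q.HasRectangleSymmetries := by
  obtain ⟨g, hg⟩ := h
  obtain ⟨⟨f1, r1, e1⟩, ⟨f2, r2, e2⟩, ⟨f3, r3, e3⟩⟩ := hp
  exact ⟨⟨_, r1.conj g, Quad.conj_apply hg e1⟩, ⟨_, r2.conj g, Quad.conj_apply hg e2⟩,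
    ⟨_, r3.conj g, Quad.conj_apply hg e3⟩⟩

theorem Quad.CongruentUnlabelled.symm {p q : Quad} (h : p.CongruentUnlabelled q) :
    q.CongruentUnlabelled p := by
  obtain ⟨f, hf⟩ := h
  refine ⟨f.symm, ?_⟩
  rw [← hf, ← image_comp]
  simp

/-- The isometry permutes vertices, so a diagonal and a side of the first rectangle each occur among
the three distances of the second, whose largest is its diagonal. -/
theorem Quad.CongruentUnlabelled.rect_sq {x y x' y' : ℝ} (hx0 : 0 < x) (hy0 : 0 < y)
    (h : (rect x y).CongruentUnlabelled (rect x' y')) : x ^ 2 + y ^ 2 ≤ x' ^ 2 + y' ^ 2 ∧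
      (x ^ 2 = x' ^ 2 ∨ x ^ 2 = y' ^ 2 ∨ x ^ 2 = x' ^ 2 + y' ^ 2) := by
  obtain ⟨f, hf⟩ := h
  have hinj := rect_injective hx0 hy0
  have hex : ∀ i, ∃ j, rect x' y' j = f (rect x y i) := fun i => by
    have : f (rect x y i) ∈ range (rect x' y') := by
      rw [← hf]; exact mem_image_of_mem f (mem_range_self i)
    exact this
  choose σ hσ using hex
  have hne : ∀ i j, i ≠ j → σ i ≠ σ j := fun i j hij e => by
    have := hσ i
    rw [e, hσ j] at this
    exact hij (hinj (f.injective this)).symm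
  have hlor : ∀ i j, lor (rect x' y' (σ i)) (rect x' y' (σ j)) = lor (rect x y i) (rect x y j) :=
    fun i j => by rw [hσ, hσ, ← dist_eq_dist_iff, f.dist_eq]
  have h20 := lor_rect_cases x' y' (σ 2) (σ 0) (hne _ _ (by decide))
  have h01 := lor_rect_cases x' y' (σ 0) (σ 1) (hne _ _ (by decide))
  rw [hlor, lor_rect_20] at h20
  rw [hlor, lor_rect_01] at h01
  constructor
  · have := sq_nonneg x'
    have := sq_nonneg y'
    rcases h20 with h | h | h <;> linarith
  · rcases h01 with h | h | h
    · left; linarith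
    · right; left; linarith
    · right; right; linarith

theorem rect_congruentUnlabelled_swap (x y : ℝ) :
    (rect x y).CongruentUnlabelled (rect y x) := by
  have h01 := lor_rect_01 y x
  have h12 := lor_rect_12 y x
  have h23 := lor_rect_23 y x
  have h30 := lor_rect_30 y x
  have h20 := lor_rect_20 y x
  have h13 := lor_rect_13 y x
  -- The relabelling `i ↦ -i` reverses the cyclic order and so exchanges the two kinds of sides.
  obtain ⟨f, hf⟩ := exists_isometry_of_dist_eq (rect x y) (fun i => rect y x (-i))
    (dist_eq_of_lor_eq
      ((lor_rect_01 x y).trans ((lor_comm _ _).trans h30).symm)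
      ((lor_rect_12 x y).trans ((lor_comm _ _).trans h23).symm)
      ((lor_rect_23 x y).trans ((lor_comm _ _).trans h12).symm)
      ((lor_rect_30 x y).trans ((lor_comm _ _).trans h01).symm)
      ((lor_rect_20 x y).trans (by rw [add_right_comm]; exact h20.symm))
      ((lor_rect_13 x y).trans (by
        rw [add_right_comm]; exact ((lor_comm _ _).trans h13).symm)))
  refine ⟨f, ?_⟩
  rw [← range_comp, show f ∘ rect x y = rect y x ∘ (fun i => -i) from funext hf]
  exact neg_surjective.range_comp _

/-! ### The one-parameter family and the square -/

/-- The coordinate `x` of the `α`-quadrangle `rect x y` with angle `γ` between the first side and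
the diagonal. -/
def leg (α γ : ℝ) : ℝ :=
  √(Real.cos α * Real.cos γ / (Real.sin α * Real.sin γ))

section leg

variable {α γ : ℝ}

theorem sin_pos_of_mem (hα : α ∈ Ioo 0 (Real.pi / 2)) : 0 < Real.sin α :=
  Real.sin_pos_of_pos_of_lt_pi hα.1 (by linarith [hα.1, hα.2])

theorem cos_pos_of_mem (hα : α ∈ Ioo 0 (Real.pi / 2)) : 0 < Real.cos α :=
  Real.cos_pos_of_mem_Ioo ⟨by linarith [hα.1, hα.2], hα.2⟩

theorem leg_arg_pos (hα : α ∈ Ioo 0 (Real.pi / 2)) (hγ : γ ∈ Ioo 0 (Real.pi / 2)) :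
    0 < Real.cos α * Real.cos γ / (Real.sin α * Real.sin γ) := by
  have := sin_pos_of_mem hα
  have := sin_pos_of_mem hγ
  have := cos_pos_of_mem hα
  have := cos_pos_of_mem hγ
  positivity

theorem leg_pos (hα : α ∈ Ioo 0 (Real.pi / 2)) (hγ : γ ∈ Ioo 0 (Real.pi / 2)) : 0 < leg α γ :=
  Real.sqrt_pos.2 (leg_arg_pos hα hγ)

theorem leg_sq (hα : α ∈ Ioo 0 (Real.pi / 2)) (hγ : γ ∈ Ioo 0 (Real.pi / 2)) :
    leg α γ ^ 2 = Real.cos α * Real.cos γ / (Real.sin α * Real.sin γ) :=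
  Real.sq_sqrt (leg_arg_pos hα hγ).le

/-- Injectivity of the cotangent: equality of the squares amounts to `sin (γ' - γ) = 0`. -/
theorem leg_sq_inj {γ' : ℝ} (hα : α ∈ Ioo 0 (Real.pi / 2)) (hγ : γ ∈ Ioo 0 (Real.pi / 2))
    (hγ' : γ' ∈ Ioo 0 (Real.pi / 2)) (h : leg α γ ^ 2 = leg α γ' ^ 2) : γ = γ' := by
  have s1 := sin_pos_of_mem hα
  have s2 := sin_pos_of_mem hγ
  have s3 := sin_pos_of_mem hγ'
  have c1 := cos_pos_of_mem hα
  rw [leg_sq hα hγ, leg_sq hα hγ'] at h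
  field_simp at h
  have h0 : Real.sin (γ' - γ) = 0 := by
    rw [Real.sin_sub]; linarith
  have := (Real.sin_eq_zero_iff_of_lt_of_lt (by linarith [hγ.1, hγ.2, hγ'.1, hγ'.2])
    (by linarith [hγ.1, hγ.2, hγ'.1, hγ'.2])).1 h0
  linarith

theorem continuousOn_leg (hα : α ∈ Ioo 0 (Real.pi / 2)) :
    ContinuousOn (leg α) (Ioo 0 (Real.pi / 2)) := by
  unfold leg
  refine ContinuousOn.sqrt (ContinuousOn.div (by fun_prop) (by fun_prop) fun γ hγ => ?_)
  exact (mul_pos (sin_pos_of_mem hα) (sin_pos_of_mem hγ)).ne'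

theorem mem_of_mem (hα : α ∈ Ioo 0 (Real.pi / 2)) (hγ : γ ∈ Ioo 0 α) :
    γ ∈ Ioo 0 (Real.pi / 2) := ⟨hγ.1, hγ.2.trans hα.2⟩

theorem sub_mem (hγ : γ ∈ Ioo 0 α) : α - γ ∈ Ioo 0 α :=
  ⟨by linarith [hγ.2], by linarith [hγ.1]⟩

/-- The `α`-quadrangle with angle `γ` between the first side and the diagonal. -/
def family (α γ : ℝ) : Quad := rect (leg α γ) (leg α (α - γ))

theorem continuousOn_family (hα : α ∈ Ioo 0 (Real.pi / 2)) :
    ContinuousOn (family α) (Ioo 0 α) := by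
  have h1 : ContinuousOn (leg α) (Ioo 0 α) :=
    (continuousOn_leg hα).mono fun γ hγ => mem_of_mem hα hγ
  have h2 : ContinuousOn (fun γ => leg α (α - γ)) (Ioo 0 α) :=
    h1.comp (by fun_prop) fun γ hγ => sub_mem hγ
  have key : ∀ f g : ℝ → ℝ, ContinuousOn f (Ioo 0 α) → ContinuousOn g (Ioo 0 α) →
      ContinuousOn (fun γ => ofXY (f γ) (g γ)) (Ioo 0 α) := fun f g hf hg =>
    continuous_ofXY.comp_continuousOn (hf.prodMk hg)
  exact continuousOn_pi.2 (forall_zmod_four (key _ _ h1 h2) (key _ _ h1.neg h2)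
    (key _ _ h1.neg h2.neg) (key _ _ h1 h2.neg))

/-- These are the angle conditions of `rect_interiorAngle` and `rect_angleAt_diagonal`. The addition
formulas for `cos (α - γ)`, `cos γ`, `sin α` and `cos α` make each sum in them a single fraction
(`e1` to `e4`). -/
theorem leg_identities (hα : α ∈ Ioo 0 (Real.pi / 2)) (hγ : γ ∈ Ioo 0 α) :
    Real.cos α ^ 2 * ((1 + leg α γ ^ 2) * (1 + leg α (α - γ) ^ 2)) =
      leg α γ ^ 2 * leg α (α - γ) ^ 2 ∧
    Real.cos γ ^ 2 * ((1 + leg α γ ^ 2) * (leg α γ ^ 2 + leg α (α - γ) ^ 2)) =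
      leg α γ ^ 2 * (1 + leg α γ ^ 2 + leg α (α - γ) ^ 2) := by
  have hγ1 := mem_of_mem hα hγ
  have hδ1 := mem_of_mem hα (sub_mem hγ)
  rw [leg_sq hα hγ1, leg_sq hα hδ1]
  have s1 := sin_pos_of_mem hα
  have s2 := sin_pos_of_mem hγ1
  have s3 := sin_pos_of_mem hδ1
  have e1 : 1 + Real.cos α * Real.cos γ / (Real.sin α * Real.sin γ) =
      Real.cos (α - γ) / (Real.sin α * Real.sin γ) := by
    rw [Real.cos_sub]; field_simp; ring
  have e2 : 1 + Real.cos α * Real.cos (α - γ) / (Real.sin α * Real.sin (α - γ)) =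
      Real.cos γ / (Real.sin α * Real.sin (α - γ)) := by
    have : Real.cos γ = Real.cos (α - (α - γ)) := by congr 1; ring
    rw [this, Real.cos_sub α (α - γ)]; field_simp; ring
  have hs : Real.sin α = Real.sin γ * Real.cos (α - γ) + Real.cos γ * Real.sin (α - γ) := by
    rw [← Real.sin_add]; congr 1; ring
  have hc : Real.cos α = Real.cos γ * Real.cos (α - γ) - Real.sin γ * Real.sin (α - γ) := by
    rw [← Real.cos_add]; congr 1; ring
  have e3 : Real.cos α * Real.cos γ / (Real.sin α * Real.sin γ) +
      Real.cos α * Real.cos (α - γ) / (Real.sin α * Real.sin (α - γ)) =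
      Real.cos α / (Real.sin γ * Real.sin (α - γ)) := by
    rw [div_add_div _ _ (by positivity) (by positivity), div_eq_div_iff (by positivity)
      (by positivity)]
    linear_combination (-(Real.cos α * Real.sin α * Real.sin γ * Real.sin (α - γ))) * hs
  have e4 : 1 + Real.cos α * Real.cos γ / (Real.sin α * Real.sin γ) +
      Real.cos α * Real.cos (α - γ) / (Real.sin α * Real.sin (α - γ)) =
      Real.cos γ * Real.cos (α - γ) / (Real.sin γ * Real.sin (α - γ)) := by
    rw [add_assoc, e3]
    field_simp
    linear_combination hc
  rw [e4, e3, e2, e1]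
  constructor <;> field_simp

theorem family_isAlphaQuadrangle (hα : α ∈ Ioo 0 (Real.pi / 2)) (hγ : γ ∈ Ioo 0 α) :
    (family α γ).IsAlphaQuadrangle α :=
  have h1 := leg_pos hα (mem_of_mem hα hγ)
  have h2 := leg_pos hα (mem_of_mem hα (sub_mem hγ))
  ⟨rect_isSimple h1 h2, rect_interiorAngle h1 h2 hα (leg_identities hα hγ).1⟩

theorem family_angleAt (hα : α ∈ Ioo 0 (Real.pi / 2)) (hγ : γ ∈ Ioo 0 α) :
    angleAt (family α γ 0) (family α γ 1) (family α γ 2) = γ :=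
  rect_angleAt_diagonal (leg_pos hα (mem_of_mem hα hγ)) (leg_pos hα (mem_of_mem hα (sub_mem hγ)))
    (mem_of_mem hα hγ) (leg_identities hα hγ).2

theorem family_congruent (hα : α ∈ Ioo 0 (Real.pi / 2)) {q : Quad} (hq : q.IsAlphaQuadrangle α) :
    angleAt (q 0) (q 1) (q 2) ∈ Ioo 0 α ∧
      (family α (angleAt (q 0) (q 1) (q 2))).Congruent q :=
  have h := (hq.lor_eq hα rfl).1
  ⟨h, (family_isAlphaQuadrangle hα h).congruent hα hq (family_angleAt hα h)⟩

theorem Quad.Congruent.angleAt_eq {p q : Quad} (h : p.Congruent q) (i j k : ZMod 4) :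
    angleAt (p i) (p j) (p k) = angleAt (q i) (q j) (q k) := by
  obtain ⟨f, hf⟩ := h
  apply angleAt_eq_of_dist <;> rw [← hf, ← hf, f.dist_eq]

theorem family_congruentUnlabelled_iff {γ' : ℝ} (hα : α ∈ Ioo 0 (Real.pi / 2))
    (hγ : γ ∈ Ioo 0 α) (hγ' : γ' ∈ Ioo 0 α) :
    (family α γ).CongruentUnlabelled (family α γ') ↔ γ' = γ ∨ γ' = α - γ := by
  constructor
  · intro h
    have p1 := leg_pos hα (mem_of_mem hα hγ)
    have p2 := leg_pos hα (mem_of_mem hα (sub_mem hγ))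
    have p3 := leg_pos hα (mem_of_mem hα hγ')
    have p4 := leg_pos hα (mem_of_mem hα (sub_mem hγ'))
    obtain ⟨l1, l2⟩ := Quad.CongruentUnlabelled.rect_sq p1 p2 h
    -- The inequalities in both directions make the diagonals equal, so a side of one rectangle
    -- cannot match a diagonal of the other.
    obtain ⟨l3, -⟩ := Quad.CongruentUnlabelled.rect_sq p3 p4 h.symm
    rcases l2 with e | e | e
    · exact Or.inl (leg_sq_inj hα (mem_of_mem hα hγ) (mem_of_mem hα hγ') e).symm
    · have := leg_sq_inj hα (mem_of_mem hα hγ) (mem_of_mem hα (sub_mem hγ')) e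
      right; linarith
    · have := pow_pos p2 2
      linarith
  · rintro (rfl | rfl)
    · exact ⟨IsometryEquiv.refl ℍ, image_id _⟩
    · have := rect_congruentUnlabelled_swap (leg α γ) (leg α (α - γ))
      unfold family
      rwa [sub_sub_cancel]

theorem Quad.HasSquareSymmetries.dist_eq {q : Quad} (h : q.HasSquareSymmetries) (i j : ZMod 4) :
    dist (q i) (q (i + 1)) = dist (q j) (q (j + 1)) := by
  by_cases hij : j = i
  · rw [hij]
  obtain ⟨f, -, hf⟩ := h.2 (j - i) (sub_ne_zero.2 hij)
  rw [← f.dist_eq, hf, hf]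
  congr 2 <;> ring

theorem Quad.IsAlphaSquare.angleAt_eq (hα : α ∈ Ioo 0 (Real.pi / 2)) {q : Quad}
    (hq : q.IsAlphaSquare α) : angleAt (q 0) (q 1) (q 2) = α / 2 := by
  obtain ⟨hγ, f, hf⟩ := family_congruent hα hq.1
  -- Equality of the adjacent sides `q 0 q 1` and `q 3 q 0` becomes equality of the two legs, that
  -- is `γ = α - γ`.
  have h := hq.2.dist_eq 0 3
  generalize angleAt (q 0) (q 1) (q 2) = γ at *
  rw [← hf, ← hf, ← hf, ← hf, f.dist_eq, f.dist_eq, dist_eq_dist_iff] at h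
  have h' : 1 + 2 * leg α γ ^ 2 = 1 + 2 * leg α (α - γ) ^ 2 :=
    (lor_rect_01 _ _).symm.trans (h.trans (lor_rect_30 _ _))
  have := leg_sq_inj hα (mem_of_mem hα hγ) (mem_of_mem hα (sub_mem hγ)) (by linarith)
  linarith

theorem family_half_isAlphaSquare (hα : α ∈ Ioo 0 (Real.pi / 2)) :
    (family α (α / 2)).IsAlphaSquare α := by
  have hα0 := hα.1
  refine ⟨family_isAlphaQuadrangle hα ⟨by linarith, by linarith⟩, ?_⟩
  unfold family
  rw [sub_half]
  exact rect_hasSquareSymmetries _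

end leg

end HypQuad

end

theorem proposition4p1 (α : ℝ) (hα : α ∈ Set.Ioo 0 (Real.pi / 2)) :
    -- the one-parameter family of all `α`-quadrangles
    (∃ F : ℝ → HypQuad.Quad,
      ContinuousOn F (Set.Ioo 0 α) ∧
      (∀ γ ∈ Set.Ioo 0 α, (F γ).IsAlphaQuadrangle α ∧
        HypQuad.angleAt (F γ 0) (F γ 1) (F γ 2) = γ) ∧
      (∀ q : HypQuad.Quad, q.IsAlphaQuadrangle α →
        ∃! γ : ℝ, γ ∈ Set.Ioo 0 α ∧ (F γ).Congruent q) ∧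
      (∀ γ ∈ Set.Ioo 0 α, ∀ γ' ∈ Set.Ioo 0 α,
        (F γ).CongruentUnlabelled (F γ') ↔ γ' = γ ∨ γ' = α - γ)) ∧
    -- the symmetries of every `α`-quadrangle
    (∀ q : HypQuad.Quad, q.IsAlphaQuadrangle α → q.HasRectangleSymmetries) ∧
    -- existence and uniqueness of the `α`-square
    (∃ s : HypQuad.Quad, s.IsAlphaSquare α ∧
      ∀ q : HypQuad.Quad, q.IsAlphaSquare α → s.Congruent q) ∧
    -- all the sides of an `α`-square have the same length
    (∀ q : HypQuad.Quad, q.IsAlphaSquare α →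
      ∀ i j, dist (q i) (q (i + 1)) = dist (q j) (q (j + 1))) := by
  open HypQuad in
  refine ⟨⟨family α, continuousOn_family hα,
    fun γ hγ => ⟨family_isAlphaQuadrangle hα hγ, family_angleAt hα hγ⟩, fun q hq => ?_,
    fun γ hγ γ' hγ' => family_congruentUnlabelled_iff hα hγ hγ'⟩, fun q hq => ?_,
    ⟨family α (α / 2), family_half_isAlphaSquare hα, fun q hq => ?_⟩,
    fun q hq => hq.2.dist_eq⟩
  -- The parameter is unique because it is an angle, which labelled congruence preserves.
  · refine ⟨_, family_congruent hα hq, fun γ ⟨hγ, h⟩ => ?_⟩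
    rw [← h.angleAt_eq, family_angleAt hα hγ]
  · exact (family_congruent hα hq).2.hasRectangleSymmetries (rect_hasRectangleSymmetries _ _)
  · refine (family_half_isAlphaSquare hα).1.congruent hα hq.1 ?_
    rw [(family_half_isAlphaSquare hα).angleAt_eq hα, hq.angleAt_eq hα]
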